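/- Let $\mathbb{C}((t))$ be the field of formal Laurent series with derivation $\frac{d}{dt}$, and identify $\mathbb{C}(t)$ with a subfield of it by expansion at $0$. For a nonzero $R\in t\,\mathbb{C}[[t]]$ let $\Phi_R$ be the field endomorphism $f(t)\mapsto f(R(t))$ of $\mathbb{C}((t))$. If $R$ vanishes at $0$ to order $d\ge 1$, write $R=t^d v$ with $v(0)\neq 0$. The field $\mathbb{C}((t))(\log t)$ is the purely transcendental extension of $\mathbb{C}((t))$ generated by an element $\log t$; it carries the extension of $\frac{d}{dt}$ with $(\log t)'=\frac1t$ and the extension of $\Phi_R$ with $\Phi_R(\log t)=d\log t+\log v$, where $\log v\in\mathbb{C}[[t]]$ is a determination of the logarithm of $v$. Let $\mathbb{F}=\mathbb{C}((t))$ if $R'(0)\ne 0$ and $\mathbb{F}=\mathbb{C}((t))(\log t)$ if $R'(0)=0$. An element $f$ of $\mathbb{F}$ is \emph{differentially algebraic} over $\mathbb{C}(t)$ if there are an integer $n\ge 0$ and a nonzero polynomial $P$ in $n+1$ variables with coefficients in $\mathbb{C}(t)$ such that $P(f,f',\dots,f^{(n)})=0$, and \emph{differentially transcendental} over $\mathbb{C}(t)$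 otherwise. \textbf{Theorem.} Let $R\in\mathbb{C}(t)$ be nonzero with $R(0)=0$, such that no iterate $R^{\circ n}$, $n\ge 1$, is the identity. Assume $(\mathcal{DT})$: there exists $\Psi\in\mathbb{F}$ with $\Phi_R(\Psi)=R'(t)\,\Psi$ that is differentially transcendental over $\mathbb{C}(t)$ with respect to $\frac{d}{dt}$. Let $a\in\mathbb{C}(t)$ and let $z\in\mathbb{C}((t))$ satisfy $\Phi_R(z)=az$. Then either $z$ is algebraic over $\mathbb{C}(t)$ and there exists a positive integer $N$ such that $z^N\in\mathbb{C}(t)$, or $z$ is differentially transcendental over $\mathbb{C}(t)$. -/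

import Mathlib

open scoped PowerSeries LaurentSeries RatFunc

noncomputable section

namespace IterativeEquation

/-! ### Differentially algebraic and differentially transcendental elements -/

/-- Let `φ : K →+* F` be a field extension and `D` the derivation of `F`. An element `f` of `F` is
differentially algebraic over `K` if `P(f, D f, …, Dⁿ f) = 0` for some `n ≥ 0` and some nonzero
polynomial `P` in `n + 1` variables with coefficients in `K`. -/
def IsDiffAlgebraic {K F : Type*} [Field K] [Field F] (φ : K →+* F) (D : F → F) (f : F) : Prop :=
  ∃ (n : ℕ) (P : MvPolynomial (Fin (n + 1)) K),
    P ≠ 0 ∧ MvPolynomial.eval₂ φ (fun i : Fin (n + 1) => D^[(i : ℕ)] f) P = 0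

/-- An element is differentially transcendental if it is not differentially algebraic. -/
def IsDiffTranscendental {K F : Type*} [Field K] [Field F] (φ : K →+* F) (D : F → F) (f : F) :
    Prop :=
  ¬ IsDiffAlgebraic φ D f

/-! ### The field `ℂ((t))` -/

/-- The expansion at `0`, identifying `ℂ(t)` with a subfield of `ℂ((t))`. -/
def expansion : RatFunc ℂ →+* ℂ⸨X⸩ := algebraMap (RatFunc ℂ) ℂ⸨X⸩

/-- The derivation `d/dt` of `ℂ((t))`. -/
def ddt : ℂ⸨X⸩ → ℂ⸨X⸩ := LaurentSeries.derivative ℂ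

theorem isUnit_subst_X (R : ℂ⟦X⟧) (h0 : PowerSeries.constantCoeff R = 0) (hR : R ≠ 0) :
    IsUnit (((HahnSeries.ofPowerSeries ℤ ℂ).comp
      (PowerSeries.substAlgHom (R := ℂ)
        (PowerSeries.HasSubst.of_constantCoeff_zero' h0)).toRingHom) (PowerSeries.X : ℂ⟦X⟧)) := by
  rw [isUnit_iff_ne_zero]
  have h : (PowerSeries.substAlgHom (R := ℂ)
      (PowerSeries.HasSubst.of_constantCoeff_zero' h0)) (PowerSeries.X : ℂ⟦X⟧) = R :=
    PowerSeries.substAlgHom_X _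
  intro hz
  apply hR
  apply HahnSeries.ofPowerSeries_injective (Γ := ℤ) (R := ℂ)
  rw [map_zero, ← hz]
  exact congrArg _ h.symm

/-- For a nonzero `R ∈ tℂ[[t]]`, the endomorphism `Φ_R : f ↦ f(R(t))` of the field `ℂ((t))`: the
extension of the substitution `f ↦ f(R(t))` of `ℂ[[t]]` to `ℂ((t)) = ℂ[[t]][1/t]`. -/
def Phi (R : ℂ⟦X⟧) (h0 : PowerSeries.constantCoeff R = 0) (hR : R ≠ 0) : ℂ⸨X⸩ →+* ℂ⸨X⸩ :=
  IsLocalization.Away.lift (PowerSeries.X : ℂ⟦X⟧) (isUnit_subst_X R h0 hR)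

/-! ### Purely transcendental extensions `L(T)` -/

/-- The field `L(T)` of rational functions in one variable `T` over the field `L`. -/
abbrev TransExt (L : Type*) [Field L] : Type _ := RatFunc L

/-- `L` as a subfield of `L(T)`. -/
def toTransExt (L : Type*) [Field L] : L →+* TransExt L := RatFunc.C

/-- Given the derivation `D` of a field `L` and `w ∈ L`, the derivation of `L[T]` that extends `D`
and sends `T` to `w`. -/
def polyDeriv {L : Type*} [Field L] (D : L → L) (w : L) (p : Polynomial L) : Polynomial L :=
  p.sum (fun n c => Polynomial.monomial n (D c)) + Polynomial.C w * Polynomial.derivative p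

/-- The derivation of `L(T)` that extends `D` and sends `T` to `w`, by the quotient rule. -/
def ratFuncDeriv {L : Type*} [Field L] (D : L → L) (w : L) (f : TransExt L) : TransExt L :=
  (algebraMap (Polynomial L) (RatFunc L) (polyDeriv D w f.num * f.denom) -
    algebraMap (Polynomial L) (RatFunc L) (f.num * polyDeriv D w f.denom)) /
    algebraMap (Polynomial L) (RatFunc L) (f.denom ^ 2)

theorem eval₂_linear_injective {L : Type*} [Field L] (φ : L →+* L) (c u : L) (hc : c ≠ 0) :
    Function.Injective (Polynomial.eval₂RingHom (Polynomial.C.comp φ)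
      (Polynomial.C c * Polynomial.X + Polynomial.C u)) := by
  have hdeg : (Polynomial.C c * Polynomial.X + Polynomial.C u).natDegree = 1 :=
    Polynomial.natDegree_linear hc
  rw [injective_iff_map_eq_zero]
  intro p hp
  have hcomp : Polynomial.eval₂RingHom (Polynomial.C.comp φ)
      (Polynomial.C c * Polynomial.X + Polynomial.C u) p =
        (p.map φ).comp (Polynomial.C c * Polynomial.X + Polynomial.C u) := by
    simp [Polynomial.comp, Polynomial.eval₂_map]
  rw [hcomp, Polynomial.comp_eq_zero_iff] at hp
  rcases hp with hp | ⟨-, hp⟩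
  · exact (Polynomial.map_eq_zero _).mp hp
  · rw [hp, Polynomial.natDegree_C] at hdeg
    exact absurd hdeg (by norm_num)

/-- The endomorphism of the field `L(T)` that extends the endomorphism `φ` of `L` and sends `T` to
`c T + u`, where `c ≠ 0`. -/
def ratFuncHom {L : Type*} [Field L] (φ : L →+* L) (c u : L) (hc : c ≠ 0) :
    TransExt L →+* TransExt L :=
  RatFunc.mapRingHom
    (Polynomial.eval₂RingHom (Polynomial.C.comp φ)
      (Polynomial.C c * Polynomial.X + Polynomial.C u))
    (nonZeroDivisors_le_comap_nonZeroDivisors_of_injective _ (eval₂_linear_injective φ c u hc))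

/-! ### The field `ℂ((t))(log t)` -/

/-- The field `ℂ((t))(log t)`: the field of rational functions over `ℂ((t))` in one variable `T`,
which stands for `log t`. -/
abbrev LogField : Type := TransExt ℂ⸨X⸩

/-- `ℂ((t))` as a subfield of `ℂ((t))(log t)`. -/
def toLogField : ℂ⸨X⸩ →+* LogField := toTransExt ℂ⸨X⸩

/-- `d/dt` on `ℂ((t))(log t)`: it is `d/dt` on `ℂ((t))`, and `(log t)' = 1/t`. -/
def ddtLog : LogField → LogField := ratFuncDeriv ddt (HahnSeries.single (-1 : ℤ) (1 : ℂ))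

/-- The order `d` of the zero of `R` at `0`. -/
def ord (R : ℂ⟦X⟧) : ℕ := R.order.toNat

/-- The coefficient of `t ^ d` in `R`, where `d` is the order of the zero of `R` at `0`. -/
def leadCoeff (R : ℂ⟦X⟧) : ℂ := PowerSeries.coeff (ord R) R

/-- The power series `log (R / t ^ d)`, where `d` is the order of `R` at `0` and the number `ℓ` is
a logarithm of the leading coefficient `r` of `R`:
`log (R / t ^ d) = ℓ + log (1 + (R / (r t ^ d) - 1))`. -/
def logUnitPart (R : ℂ⟦X⟧) (ℓ : ℂ) : ℂ⟦X⟧ :=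
  PowerSeries.C ℓ +
    PowerSeries.logOf (PowerSeries.C (leadCoeff R)⁻¹ * PowerSeries.divXPowOrder R)

theorem ord_cast_ne_zero (R : ℂ⟦X⟧) (h0 : PowerSeries.constantCoeff R = 0) (hR : R ≠ 0) :
    (HahnSeries.C (ord R : ℂ) : ℂ⸨X⸩) ≠ 0 := by
  have h : ord R ≠ 0 := by
    intro h
    rw [ord, ENat.toNat_eq_zero] at h
    rcases h with h | h
    · exact PowerSeries.order_ne_zero_iff_constCoeff_eq_zero.mpr h0 h
    · exact hR (PowerSeries.order_eq_top.mp h)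
  exact (map_ne_zero _).mpr (Nat.cast_ne_zero.mpr h)

/-- `Φ_R` on the field `ℂ((t))(log t)`: it is `Φ_R` on `ℂ((t))`, and it sends `log t` to
`log (R(t)) = d log t + log (R / t ^ d)`. -/
def PhiLog (R : ℂ⟦X⟧) (h0 : PowerSeries.constantCoeff R = 0) (hR : R ≠ 0) (ℓ : ℂ) :
    LogField →+* LogField :=
  ratFuncHom (Phi R h0 hR) (HahnSeries.C (ord R : ℂ))
    (HahnSeries.ofPowerSeries ℤ ℂ (logUnitPart R ℓ)) (ord_cast_ne_zero R h0 hR)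

/-! ### The standing assumption -/

/-- The iterate `R ∘ ⋯ ∘ R` (`n` factors). -/
def iter (R : ℂ⟦X⟧) : ℕ → ℂ⟦X⟧
  | 0 => PowerSeries.X
  | n + 1 => PowerSeries.subst R (iter R n)

/-- Assumption (DT) on `R`, a rational function identified with its expansion at `0`. The field
that contains `Ψ` is `ℂ((t))` if `R'(0) ≠ 0`, and `ℂ((t))(log t)` if `R'(0) = 0`; in the latter case
any determination of `log (R(t))` is allowed. -/
structure DT (R : ℂ⟦X⟧) : Prop where
  ne_zero : R ≠ 0
  map_zero : PowerSeries.constantCoeff R = 0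
  rational : HahnSeries.ofPowerSeries ℤ ℂ R ∈ expansion.range
  iter_ne : ∀ n : ℕ, 0 < n → iter R n ≠ PowerSeries.X
  exists_psi :
    (PowerSeries.coeff 1 R ≠ 0 ∧ ∃ Ψ : ℂ⸨X⸩,
      Phi R map_zero ne_zero Ψ =
        HahnSeries.ofPowerSeries ℤ ℂ (PowerSeries.derivative ℂ R) * Ψ ∧
      IsDiffTranscendental expansion ddt Ψ) ∨
    (PowerSeries.coeff 1 R = 0 ∧ ∃ ℓ : ℂ, Complex.exp ℓ = leadCoeff R ∧ ∃ Ψ : LogField,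
      PhiLog R map_zero ne_zero ℓ Ψ =
        toLogField (HahnSeries.ofPowerSeries ℤ ℂ (PowerSeries.derivative ℂ R)) * Ψ ∧
      IsDiffTranscendental (toLogField.comp expansion) ddtLog Ψ)

end IterativeEquation

end

/-!
Put `D = Ψ d/dt`. Since `Φ_R(Ψ) = R' Ψ`, the chain rule says that `D` commutes with `Φ_R`. If
`Φ_R(z) = a z`, the logarithmic derivative `y = z'/z` satisfies `R' Φ_R(y) = y + b` with
`b = a'/a`, so that `u = Ψ y` satisfies `Φ_R(u) = u + Ψ b`, and each `D^i u` satisfies an equation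
`Φ_R(v) = v + b_i` with `b_i` in the differential field `L` generated by `Ψ` over `ℂ(t)`.

If `z` is differentially algebraic, the `D^i u` are algebraically dependent over `L`. Solutions of
such additive equations are algebraically dependent only if a nontrivial linear combination of
them, with coefficients fixed by `Φ_R` and hence in `ℂ`, lies in `L`. Modulo terms of lower order
in `Ψ`, the function `D^N u` is `y Ψ^N Ψ^(N)`; as the `Ψ^(i)` are still algebraically independent
over almost all of the finitely generated differential field generated by `z`, such a relation
forces `y ∈ ℂ(t)`.

Write `y = g' + ∑ r_α / (t - α)`. Comparing residues, `T r = r + n` with `n` integral, where the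
integer matrix `T` describes the action of `w ↦ R' Φ_R(w)` on residues. A rational solution
`w ≠ 0` of `R' Φ_R(w) = w` would make `Ψ w` invariant under `Φ_R`, hence constant, and `Ψ`
rational; so `T - 1` is injective. Applying `ℚ`-linear forms on `ℂ` that vanish at `1` shows that
the `r_α` are rational, and `g' = 0`. Hence `N y = v'/v` for some `N ≥ 1` and `v ∈ ℂ(t)`, and
`z ^ N / v` is constant.
-/

namespace IterativeEquation

/-! ### Algebraic relations between solutions of `Φ u = u + b` -/

section Ostrowski

open MvPolynomial

variable {ι L F : Type*} [Field L] [Field F]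

/-- The endomorphism of `L[X_i : i ∈ ι]` acting as `φ` on `L` and by `X_i ↦ X_i + b_i`. If
`Φ u_i = u_i + b_i` for an extension `Φ` of `φ`, then evaluation at `u` intertwines it with `Φ`. -/
noncomputable def twistedShift (φ : L →+* L) (b : ι → L) : MvPolynomial ι L →+* MvPolynomial ι L :=
  eval₂Hom (C.comp φ) (fun i => X i + C (b i))

@[simp] lemma twistedShift_C (φ : L →+* L) (b : ι → L) (c : L) :
    twistedShift φ b (C c) = C (φ c) := by simp [twistedShift]

@[simp] lemma twistedShift_X (φ : L →+* L) (b : ι → L) (i : ι) :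
    twistedShift φ b (X i) = X i + C (b i) := by simp [twistedShift]

lemma aeval_twistedShift [Algebra L F] {φ : L →+* L} {Φ : F →+* F}
    (hΦ : ∀ x, Φ (algebraMap L F x) = algebraMap L F (φ x)) {b : ι → L} {u : ι → F}
    (hu : ∀ i, Φ (u i) = u i + algebraMap L F (b i)) (P : MvPolynomial ι L) :
    aeval u (twistedShift φ b P) = Φ (aeval u P) := by
  induction P using MvPolynomial.induction_on with
  | C c => simp [hΦ]
  | add p q hp hq => simp [hp, hq]
  | mul_X p i hp => simp [hp, hu]

lemma pderiv_twistedShift (φ : L →+* L) (b : ι → L) (i : ι) (P : MvPolynomial ι L) :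
    pderiv i (twistedShift φ b P) = twistedShift φ b (pderiv i P) := by
  classical
  induction P using MvPolynomial.induction_on with
  | C c => simp
  | add p q hp hq => simp [hp, hq]
  | mul_X p j hp =>
    simp only [map_mul, Derivation.leibniz, hp, smul_eq_mul, twistedShift_X, map_add, pderiv_C,
      add_zero, pderiv_X]
    congr 2
    by_cases h : i = j <;> simp [h]

lemma exists_eq_add_single_one {m : ι →₀ ℕ} (hm : m ≠ 0) :
    ∃ k i, m = k + Finsupp.single i 1 := by
  obtain ⟨i, hi⟩ := Finsupp.ne_iff.mp hm
  exact ⟨m - Finsupp.single i 1, i, (tsub_add_cancel_of_le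
    (Finsupp.single_le_iff.mpr (Nat.one_le_iff_ne_zero.mpr hi))).symm⟩

lemma totalDegree_pderiv_le (i : ι) (P : MvPolynomial ι L) :
    (pderiv i P).totalDegree ≤ P.totalDegree - 1 := by
  refine Finset.sup_le fun m hm => ?_
  rw [mem_support_iff, coeff_pderiv] at hm
  have hle : (m + Finsupp.single i 1).degree ≤ P.totalDegree :=
    le_totalDegree (mem_support_iff.mpr (left_ne_zero_of_mul hm))
  rw [map_add, Finsupp.degree_single] at hle
  exact Nat.le_sub_one_of_lt hle

lemma coeff_twistedShift [CharZero L] (φ : L →+* L) (b : ι → L) (P : MvPolynomial ι L)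
    (m : ι →₀ ℕ) (hm : P.totalDegree ≤ m.degree) :
    coeff m (twistedShift φ b P) = φ (coeff m P) := by
  induction hn : m.degree generalizing m P with
  | zero =>
    obtain rfl : m = 0 := (Finsupp.degree_eq_zero_iff m).mp hn
    rw [totalDegree_eq_zero_iff_eq_C.mp (Nat.le_zero.mp (hm.trans_eq hn))]
    simp
  | succ n ih =>
    obtain ⟨k, i, rfl⟩ := exists_eq_add_single_one (m := m) (by rintro rfl; simp at hn)
    have hk : k.degree = n := by simpa using hn
    have hderiv := ih (pderiv i P) k ((totalDegree_pderiv_le i P).trans (by omega)) hk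
    rw [← pderiv_twistedShift, coeff_pderiv, coeff_pderiv, map_mul, map_add, map_natCast,
      map_one] at hderiv
    exact mul_right_cancel₀ (Nat.cast_add_one_ne_zero (k i)) hderiv

lemma totalDegree_twistedShift_le [CharZero L] (φ : L →+* L) (b : ι → L) (P : MvPolynomial ι L) :
    (twistedShift φ b P).totalDegree ≤ P.totalDegree := by
  refine Finset.sup_le fun m hm => ?_
  by_contra! h
  change P.totalDegree < m.degree at h
  rw [mem_support_iff, coeff_twistedShift φ b P m h.le, coeff_eq_zero_of_totalDegree_lt h,
    map_zero] at hm
  exact hm rfl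

lemma homogeneousComponent_twistedShift [CharZero L] (φ : L →+* L) (b : ι → L)
    {P : MvPolynomial ι L} {d : ℕ} (hP : P.totalDegree ≤ d) :
    homogeneousComponent d (twistedShift φ b P) = map φ (homogeneousComponent d P) := by
  ext m
  rw [coeff_map, coeff_homogeneousComponent, coeff_homogeneousComponent]
  split_ifs with hm
  · exact coeff_twistedShift φ b P m (hm ▸ hP)
  · exact (map_zero φ).symm

lemma totalDegree_ne_zero_of_aeval_eq_zero [Algebra L F] {u : ι → F} {P : MvPolynomial ι L}
    (hP : aeval u P = 0) (hP_ne : P ≠ 0) : P.totalDegree ≠ 0 := fun h0 => by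
  rw [totalDegree_eq_zero_iff_eq_C.mp h0, aeval_C, map_eq_zero] at hP
  rw [totalDegree_eq_zero_iff_eq_C.mp h0, hP, C_0] at hP_ne
  exact hP_ne rfl

lemma totalDegree_lt_of_homogeneousComponent_eq_zero {P : MvPolynomial ι L} {d : ℕ} (hd : d ≠ 0)
    (hP : P.totalDegree ≤ d) (h : homogeneousComponent d P = 0) : P.totalDegree < d := by
  refine (Finset.sup_lt_iff (Nat.pos_of_ne_zero hd)).mpr fun m hm => ?_
  refine lt_of_le_of_ne ((le_totalDegree hm).trans hP) fun hmd : m.degree = d =>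
    mem_support_iff.mp hm ?_
  rw [← coeff_zero m, ← h, coeff_homogeneousComponent, if_pos hmd]

lemma exists_mem_map_eq_self {φ : L →+* L} {W : Submodule L (MvPolynomial ι L)} (hW : W ≠ ⊥)
    (hφ : ∀ P ∈ W, map φ P ∈ W) : ∃ P ∈ W, P ≠ 0 ∧ map φ P = P := by
  obtain ⟨P₀, hP₀, hP₀_ne⟩ := Submodule.exists_mem_ne_zero_of_ne_bot hW
  obtain ⟨P, ⟨hP, hP_ne⟩, hmin⟩ := exists_minimalFor_of_wellFoundedLT
    (fun P => P ∈ W ∧ P ≠ 0) (fun P : MvPolynomial ι L => P.support.card) ⟨P₀, hP₀, hP₀_ne⟩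
  obtain ⟨m, hm⟩ := ne_zero_iff.mp hP_ne
  set Q := (coeff m P)⁻¹ • P with hQ
  have hQW : Q ∈ W := W.smul_mem _ hP
  have hQm : coeff m Q = 1 := by rw [hQ, coeff_smul, smul_eq_mul, inv_mul_cancel₀ hm]
  refine ⟨Q, hQW, by rw [hQ]; exact smul_ne_zero (inv_ne_zero hm) hP_ne, ?_⟩
  by_contra hne
  have hlt : (map φ Q - Q).support.card < P.support.card := by
    refine Finset.card_lt_card (Finset.ssubset_iff_of_subset (fun k hk => ?_) |>.mpr
      ⟨m, mem_support_iff.mpr hm, by simp [coeff_map, hQm]⟩)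
    rw [mem_support_iff] at hk ⊢
    intro hPk
    simp [coeff_map, hQ, hPk] at hk
  exact hlt.not_ge (hmin ⟨W.sub_mem (hφ Q hQW) hQW, sub_ne_zero.mpr hne⟩ hlt.le)

/-- Among the relations satisfied by `u`, one of minimal degree can be chosen invariant: the leading
forms of the relations of minimal degree form a space stable under `φ`. -/
lemma exists_twistedShift_eq_self [CharZero L] [Algebra L F] {φ : L →+* L} {Φ : F →+* F}
    (hΦ : ∀ x, Φ (algebraMap L F x) = algebraMap L F (φ x)) {b : ι → L} {u : ι → F}
    (hu : ∀ i, Φ (u i) = u i + algebraMap L F (b i)) (hdep : ¬ AlgebraicIndependent L u) :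
    ∃ P : MvPolynomial ι L, P ≠ 0 ∧ aeval u P = 0 ∧ twistedShift φ b P = P ∧
      ∀ Q : MvPolynomial ι L, aeval u Q = 0 → Q.totalDegree < P.totalDegree → Q = 0 := by
  rw [algebraicIndependent_iff] at hdep
  push Not at hdep
  obtain ⟨P₀, hP₀⟩ := hdep
  obtain ⟨P₁, ⟨hP₁, hP₁_ne⟩, hmin⟩ := exists_minimalFor_of_wellFoundedLT
    (fun P : MvPolynomial ι L => aeval u P = 0 ∧ P ≠ 0) totalDegree ⟨P₀, hP₀⟩
  set d := P₁.totalDegree with hd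
  have hsmall (Q : MvPolynomial ι L) (hQ : aeval u Q = 0) (hlt : Q.totalDegree < d) : Q = 0 := by
    by_contra hne
    exact hlt.not_ge (hmin ⟨hQ, hne⟩ hlt.le)
  have hd0 : d ≠ 0 := totalDegree_ne_zero_of_aeval_eq_zero hP₁ hP₁_ne
  let V := LinearMap.ker (aeval (R := L) u).toLinearMap ⊓ restrictTotalDegree ι L d
  have hV {P : MvPolynomial ι L} : P ∈ V ↔ aeval u P = 0 ∧ P.totalDegree ≤ d := by
    simp [V, mem_restrictTotalDegree]
  have hVshift {P : MvPolynomial ι L} (hP : P ∈ V) : twistedShift φ b P ∈ V := by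
    rw [hV] at hP ⊢
    exact ⟨by rw [aeval_twistedShift hΦ hu, hP.1, map_zero],
      (totalDegree_twistedShift_le φ b P).trans hP.2⟩
  have hlead {P : MvPolynomial ι L} (hP : P ∈ V) (h0 : homogeneousComponent d P = 0) : P = 0 :=
    hsmall P (hV.mp hP).1
      (totalDegree_lt_of_homogeneousComponent_eq_zero hd0 (hV.mp hP).2 h0)
  obtain ⟨-, ⟨P, hP, rfl⟩, hne, hfix⟩ := exists_mem_map_eq_self (φ := φ)
    (W := V.map (homogeneousComponent d))
    (fun hbot => hP₁_ne (hlead (hV.mpr ⟨hP₁, hd.ge⟩)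
      ((Submodule.eq_bot_iff _).mp hbot _ ⟨P₁, hV.mpr ⟨hP₁, hd.ge⟩, rfl⟩)))
    (by
      rintro _ ⟨P, hP, rfl⟩
      exact ⟨twistedShift φ b P, hVshift hP, homogeneousComponent_twistedShift φ b (hV.mp hP).2⟩)
  refine ⟨P, fun h => hne (by rw [h, map_zero]), (hV.mp hP).1, sub_eq_zero.mp
    (hlead (V.sub_mem (hVshift hP) hP) ?_),
    fun Q hQ hlt => hsmall Q hQ (hlt.trans_le (hV.mp hP).2)⟩
  rw [map_sub, homogeneousComponent_twistedShift φ b (hV.mp hP).2, hfix, sub_self]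

lemma totalDegree_le_one_of_pderiv_eq_C [CharZero L] {P : MvPolynomial ι L}
    (h : ∀ i, ∃ c, pderiv i P = C c) : P.totalDegree ≤ 1 := by
  classical
  refine Finset.sup_le fun m hm => ?_
  change m.degree ≤ 1
  rw [mem_support_iff] at hm
  rcases eq_or_ne m 0 with rfl | hm0
  · simp
  obtain ⟨k, i, rfl⟩ := exists_eq_add_single_one hm0
  obtain ⟨c, hc⟩ := h i
  have hk := congrArg (coeff k) hc
  rw [coeff_pderiv, coeff_C] at hk
  rcases eq_or_ne k 0 with rfl | hk0
  · simp
  · rw [if_neg hk0.symm] at hk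
    exact absurd hk (mul_ne_zero hm (Nat.cast_add_one_ne_zero (k i)))

lemma eq_C_add_sum_of_totalDegree_le_one {P : MvPolynomial ι L} (hP : P.totalDegree ≤ 1) :
    ∃ (a : L) (c : ι →₀ L), P = C a + c.sum fun i r => r • X i := by
  have hlin : homogeneousComponent 1 P ∈ Submodule.span L (Set.range (X : ι → MvPolynomial ι L)) :=
    homogeneousSubmodule_one_eq_span_X (σ := ι) (R := L) ▸ homogeneousComponent_mem 1 P
  obtain ⟨c, hc⟩ := Finsupp.mem_span_range_iff_exists_finsupp.mp hlin
  refine ⟨coeff 0 P, c, ?_⟩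
  rw [hc, ← homogeneousComponent_zero]
  nth_rw 1 [← sum_homogeneousComponent P]
  rw [Finset.sum_subset (Finset.range_mono (Nat.succ_le_succ hP)) fun i _ hi =>
      homogeneousComponent_eq_zero _ _ (by simpa using hi)]
  simp [Finset.sum_range_succ]

lemma coeff_single_sum_smul_X (c : ι →₀ L) (i : ι) :
    coeff (Finsupp.single i 1) (c.sum fun j r => r • X j) = c i := by
  classical
  simp [Finsupp.sum, coeff_sum, coeff_X, Finsupp.single_left_inj, eq_comm]

/-- An analogue of the Kolchin–Ostrowski theorem for the difference operator `Φ`. -/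
theorem exists_linearCombination_mem_range [CharZero L] [Algebra L F] {φ : L →+* L} {Φ : F →+* F}
    (hΦ : ∀ x, Φ (algebraMap L F x) = algebraMap L F (φ x))
    (hfix : ∀ x, Φ x = x → x ∈ (algebraMap L F).range) {b : ι → L} {u : ι → F}
    (hu : ∀ i, Φ (u i) = u i + algebraMap L F (b i)) (hdep : ¬ AlgebraicIndependent L u) :
    ∃ c : ι →₀ L, c ≠ 0 ∧ (∀ i, φ (c i) = c i) ∧
      Finsupp.linearCombination L u c ∈ (algebraMap L F).range := by
  classical
  obtain ⟨P, hP_ne, hPu, hP, hmin⟩ := exists_twistedShift_eq_self hΦ hu hdep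
  have hdeg0 := totalDegree_ne_zero_of_aeval_eq_zero hPu hP_ne
  have hdeg : P.totalDegree ≤ 1 := totalDegree_le_one_of_pderiv_eq_C fun i => by
    obtain ⟨c, hc⟩ := hfix (aeval u (pderiv i P)) (by
      rw [← aeval_twistedShift hΦ hu, ← pderiv_twistedShift, hP])
    refine ⟨c, sub_eq_zero.mp (hmin _ (by rw [map_sub, aeval_C, hc, sub_self]) ?_)⟩
    refine (totalDegree_sub_C_le _ c).trans_lt ((totalDegree_pderiv_le i P).trans_lt ?_)
    omega
  obtain ⟨a, c, hPc⟩ := eq_C_add_sum_of_totalDegree_le_one hdeg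
  refine ⟨c, ?_, fun i => ?_, -a, ?_⟩
  · rintro rfl
    exact hdeg0 (by simp [hPc])
  · have hcoeff : coeff (Finsupp.single i 1) P = c i := by
      rw [hPc, coeff_add, coeff_single_sum_smul_X, coeff_C,
        if_neg (Finsupp.single_ne_zero.mpr one_ne_zero).symm, zero_add]
    rw [← hcoeff, ← coeff_twistedShift φ b P _ (by simpa using hdeg), hP]
  · have hlin : algebraMap L F a + Finsupp.linearCombination L u c = 0 := by
      simpa [hPc, Finsupp.linearCombination_apply, Finsupp.sum, map_sum] using hPu
    rw [map_neg, neg_eq_iff_add_eq_zero, hlin]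

end Ostrowski

/-! ### Differential transcendence over differential subfields -/

section DifferentialSubfields

open IntermediateField

variable {K F : Type*} [Field K] [Field F] [Algebra K F]

lemma algebraicIndependent_nat_iff {x : ℕ → F} :
    AlgebraicIndependent K x ↔ ∀ n : ℕ, AlgebraicIndependent K fun i : Fin n => x i := by
  refine ⟨fun h n => h.comp _ Fin.val_injective, fun h => ?_⟩
  refine algebraicIndependent_of_finite_type fun t ht => ?_
  obtain ⟨n, hn⟩ := ht.bddAbove
  exact (h (n + 1)).comp (fun i : t => ⟨i, Nat.lt_succ_of_le (hn i.2)⟩) fun i j hij =>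
    Subtype.ext (congrArg Fin.val hij)

lemma isDiffTranscendental_iff (D : F → F) (f : F) :
    IsDiffTranscendental (algebraMap K F) D f ↔ AlgebraicIndependent K fun i : ℕ => D^[i] f := by
  constructor
  · refine fun h => algebraicIndependent_nat_iff.mpr fun n => ?_
    have hsucc : AlgebraicIndependent K fun i : Fin (n + 1) => D^[i] f :=
      algebraicIndependent_iff.mpr fun P hP => by_contra fun h0 => h ⟨n, P, h0, hP⟩
    exact hsucc.comp Fin.castSucc (Fin.castSucc_injective n)
  · rintro h ⟨n, P, hP, h0⟩
    exact hP (algebraicIndependent_iff.mp (algebraicIndependent_nat_iff.mp h (n + 1)) P h0)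

lemma not_algebraicIndependent_of_finTrdeg {E : IntermediateField K F} [FinTrdeg K E]
    {x : ℕ → F} (hx : ∀ i, x i ∈ E) : ¬ AlgebraicIndependent K x := by
  intro h
  have hE : AlgebraicIndependent K (fun i => (⟨x i, hx i⟩ : E)) := .of_comp E.val h
  have := finite_of_algebraicIndependent hE
  exact not_finite ℕ

lemma exists_isAlgebraic_adjoin_Iio {x : ℕ → F} (hx : ¬ AlgebraicIndependent K x) :
    ∃ n, IsAlgebraic (Algebra.adjoin K (x '' Set.Iio n)) (x n) := by
  by_contra! h
  have hIio (n : ℕ) : AlgebraicIndepOn K x (Set.Iio n) := by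
    induction n with
    | zero =>
      have : IsEmpty (Set.Iio 0) := ⟨fun i => Nat.not_lt_zero _ i.2⟩
      exact algebraicIndependent_empty_type
    | succ n ih =>
      rw [← Order.succ_eq_add_one, Order.Iio_succ_eq_insert]
      exact ih.insert (h n)
  exact hx (algebraicIndependent_nat_iff.mpr fun n =>
    (hIio n).comp (fun i : Fin n => ⟨i, i.2⟩) fun i j hij => Fin.ext (congrArg Subtype.val hij))

lemma map_mem_of_mem_adjoin {Φ : F →+* F}
    (hK : ∀ k : K, Φ (algebraMap K F k) ∈ (algebraMap K F).range)
    {S : Set F} {E : IntermediateField K F} (hS : ∀ s ∈ S, Φ s ∈ E)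
    {x : F} (hx : x ∈ adjoin K S) : Φ x ∈ E := by
  induction hx using adjoin_induction with
  | mem x hx => exact hS x hx
  | algebraMap k =>
    obtain ⟨l, hl⟩ := hK k
    exact hl ▸ E.algebraMap_mem l
  | add x y _ _ hx hy => exact map_add Φ x y ▸ E.add_mem hx hy
  | inv x _ ih => exact map_inv₀ Φ x ▸ E.inv_mem ih
  | mul x y _ _ hx hy => exact map_mul Φ x y ▸ E.mul_mem hx hy

variable (δ : Derivation ℤ F F)

lemma derivation_mem_of_mem_adjoin (hK : ∀ k : K, δ (algebraMap K F k) ∈ (algebraMap K F).range)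
    {S : Set F} {E : IntermediateField K F} (hS : S ⊆ E) (hδS : ∀ s ∈ S, δ s ∈ E)
    {x : F} (hx : x ∈ adjoin K S) : δ x ∈ E := by
  have hle : adjoin K S ≤ E := adjoin_le_iff.mpr hS
  induction hx using adjoin_induction with
  | mem x hx => exact hδS x hx
  | algebraMap k =>
    obtain ⟨l, hl⟩ := hK k
    exact hl ▸ E.algebraMap_mem l
  | add x y _ _ hx hy => exact map_add δ x y ▸ E.add_mem hx hy
  | inv x hx ih =>
    rw [Derivation.leibniz_inv]
    exact E.mul_mem (E.neg_mem (pow_mem (E.inv_mem (hle hx)) 2)) ih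
  | mul x y hx hy ihx ihy =>
    rw [Derivation.leibniz]
    exact E.add_mem (E.mul_mem (hle hx) ihy) (E.mul_mem (hle hy) ihx)

lemma derivation_mem_of_mem_algebraAdjoin {R : Type*} [CommRing R] [Algebra R F]
    {S : Set F} {A : Subalgebra R F} (hR : ∀ r : R, δ (algebraMap R F r) ∈ A) (hS : S ⊆ A)
    (hδS : ∀ s ∈ S, δ s ∈ A) {x : F} (hx : x ∈ Algebra.adjoin R S) : δ x ∈ A := by
  have hle : Algebra.adjoin R S ≤ A := Algebra.adjoin_le hS
  induction hx using Algebra.adjoin_induction with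
  | mem x hx => exact hδS x hx
  | algebraMap r => exact hR r
  | add x y _ _ hx hy => exact map_add δ x y ▸ A.add_mem hx hy
  | mul x y hx hy ihx ihy =>
    rw [Derivation.leibniz]
    exact A.add_mem (A.mul_mem (hle hx) ihy) (A.mul_mem (hle hy) ihx)

lemma derivation_aeval_sub_mem {E E' : IntermediateField K F} (hE : ∀ x ∈ E, δ x ∈ E')
    {x : F} (hx : x ∈ E') (p : Polynomial E) :
    δ (Polynomial.aeval x p) - Polynomial.aeval x p.derivative * δ x ∈ E' := by
  induction p using Polynomial.induction_on' with
  | add p q hp hq =>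
    convert E'.add_mem hp hq using 1
    simp only [map_add]
    ring
  | monomial n a =>
    convert E'.mul_mem (pow_mem hx n) (hE _ a.2) using 1
    rw [Polynomial.aeval_monomial, Polynomial.derivative_monomial, Polynomial.aeval_monomial,
      Derivation.leibniz, Derivation.leibniz_pow]
    simp only [smul_eq_mul, nsmul_eq_mul, IntermediateField.algebraMap_apply, map_mul, map_natCast]
    ring

lemma derivation_mem_of_isAlgebraic [CharZero F] {E E' : IntermediateField K F} (hle : E ≤ E')
    (hE : ∀ x ∈ E, δ x ∈ E') {x : F} (hx : x ∈ E') (halg : IsAlgebraic E x) : δ x ∈ E' := by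
  set p := minpoly E x
  have hne : Polynomial.aeval x p.derivative ≠ 0 :=
    (minpoly.irreducible halg.isIntegral).separable.aeval_derivative_ne_zero (minpoly.aeval E x)
  have hmem : Polynomial.aeval x p.derivative ∈ E' := by
    rw [Polynomial.aeval_eq_sum_range]
    refine E'.sum_mem fun i _ => ?_
    rw [Algebra.smul_def]
    exact E'.mul_mem (hle (Subtype.mem _)) (pow_mem hx i)
  have hδ := derivation_aeval_sub_mem δ hE hx p
  rw [minpoly.aeval, map_zero, zero_sub] at hδ
  simpa [hne] using E'.div_mem (E'.neg_mem hδ) hmem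

theorem exists_fg_differential_subfield [CharZero F]
    (hK : ∀ k : K, δ (algebraMap K F k) ∈ (algebraMap K F).range) {f : F}
    (hf : ¬ AlgebraicIndependent K fun i : ℕ => δ^[i] f) :
    ∃ M : IntermediateField K F, M.FG ∧ f ∈ M ∧ ∀ x ∈ M, δ x ∈ M := by
  set x : ℕ → F := fun i => δ^[i] f
  have hδx (i : ℕ) : δ (x i) = x (i + 1) := (Function.iterate_succ_apply' δ i f).symm
  obtain ⟨n, hn⟩ := exists_isAlgebraic_adjoin_Iio hf
  set E := adjoin K (x '' Set.Iio n)
  set M := adjoin K (x '' Set.Iio (n + 1))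
  have hxM {i : ℕ} (hi : i < n + 1) : x i ∈ M := subset_adjoin _ _ ⟨i, hi, rfl⟩
  have hEM : E ≤ M := adjoin.mono _ _ _ (Set.image_mono (Set.Iio_subset_Iio n.le_succ))
  have hδE : ∀ y ∈ E, δ y ∈ M := by
    refine fun y hy => derivation_mem_of_mem_adjoin δ hK ((subset_adjoin _ _).trans hEM) ?_ hy
    rintro _ ⟨i, hi, rfl⟩
    exact hδx i ▸ hxM (Nat.succ_lt_succ hi)
  -- Differentiating the minimal polynomial of `δ^[n] f` expresses `δ^[n + 1] f` rationally.
  have hδn : δ (x n) ∈ M := derivation_mem_of_isAlgebraic δ hEM hδE (hxM n.lt_succ_self)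
    (hn.tower_top_of_subalgebra_le (B := E.toSubalgebra) (algebra_adjoin_le_adjoin K _))
  refine ⟨M, fg_adjoin_of_finite ((Set.finite_Iio _).image _), hxM n.succ_pos, fun y hy =>
    derivation_mem_of_mem_adjoin δ hK (subset_adjoin _ _) ?_ hy⟩
  rintro _ ⟨i, hi, rfl⟩
  rcases Nat.lt_succ_iff_lt_or_eq.mp hi with hi | rfl
  · exact hδx i ▸ hxM (Nat.succ_lt_succ hi)
  · exact hδn

lemma iterate_mem {M : IntermediateField K F} (hM : ∀ x ∈ M, δ x ∈ M) {x : F} (hx : x ∈ M)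
    (i : ℕ) : δ^[i] x ∈ M :=
  (show Set.MapsTo δ M M from hM).iterate i hx

theorem algebraicIndependent_iterate_of_fg [CharZero F] {f : F}
    (hf : AlgebraicIndependent K fun i : ℕ => δ^[i] f) {M : IntermediateField K F} (hfg : M.FG)
    (hM : ∀ x ∈ M, δ x ∈ M) : AlgebraicIndependent M fun i : ℕ => δ^[i] f := by
  by_contra h
  obtain ⟨E, hEfg, hfE, hE⟩ := exists_fg_differential_subfield δ
    (fun k : M => ⟨⟨_, hM _ k.2⟩, rfl⟩) h
  have : Algebra.EssFiniteType K M := essFiniteType_iff.mpr hfg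
  have : Algebra.EssFiniteType M E := essFiniteType_iff.mpr hEfg
  have : FinTrdeg K (E.restrictScalars K) := FinTrdeg.trans K M E
  exact not_algebraicIndependent_of_finTrdeg (E := E.restrictScalars K)
    (fun i => iterate_mem δ hE hfE i) hf

end DifferentialSubfields

section LeadingTerm

open IntermediateField MvPolynomial

variable {ι K M F : Type*} [Field K] [Field M] [Field F] [Algebra K M] [Algebra M F]

lemma mem_range_map_of_map_mul_mem_range {Q : MvPolynomial ι K} (hQ : Q ≠ 0)
    {S : MvPolynomial ι M}
    (h : map (algebraMap K M) Q * S ∈ (map (σ := ι) (algebraMap K M)).range) :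
    S ∈ (map (σ := ι) (algebraMap K M)).range := by
  classical
  obtain ⟨P, hP⟩ := h
  -- A `K`-linear retraction of `K → M`, applied to coefficients, fixes `P` and commutes with `Q *`.
  obtain ⟨π, hπ⟩ := (Algebra.linearMap K M).exists_leftInverse_of_injective
    (LinearMap.ker_eq_bot.mpr (algebraMap K M).injective)
  have hπK (k : K) : π (algebraMap K M k) = k := LinearMap.congr_fun hπ k
  let T : MvPolynomial ι K := ∑ m ∈ S.support, monomial m (π (coeff m S))
  have hT (m : ι →₀ ℕ) : coeff m T = π (coeff m S) := by
    simp +contextual [T, coeff_sum, coeff_monomial]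
  have hQT : Q * T = P := by
    ext m
    have hm := congrArg (fun p => π (coeff m p)) hP
    simp only [coeff_mul, coeff_map, hπK, map_sum] at hm
    rw [coeff_mul, hm]
    exact Finset.sum_congr rfl fun x _ => by rw [hT, ← Algebra.smul_def, map_smul, smul_eq_mul]
  refine ⟨T, mul_left_cancel₀ (a := map (algebraMap K M) Q) ?_ (by rw [← map_mul, hQT, hP])⟩
  exact (map_ne_zero_iff _ (map_injective _ (algebraMap K M).injective)).mpr hQ

lemma mem_range_map_of_aeval_mem_adjoin [Algebra K F] [IsScalarTower K M F] {x : ι → F}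
    (hx : AlgebraicIndependent M x) {S : MvPolynomial ι M}
    (hS : aeval x S ∈ adjoin K (Set.range x)) : S ∈ (map (σ := ι) (algebraMap K M)).range := by
  obtain ⟨P, Q, h⟩ := (mem_adjoin_range_iff K x _).mp hS
  by_cases hQ : aeval x Q = 0
  · rw [hQ, div_zero] at h
    exact ⟨0, by rw [map_zero, algebraicIndependent_iff.mp hx S h]⟩
  · refine mem_range_map_of_map_mul_mem_range (Q := Q) (by rintro rfl; simp at hQ) ⟨P, hx ?_⟩
    rw [map_mul, aeval_map_algebraMap, aeval_map_algebraMap, h, mul_div_cancel₀ _ hQ]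

lemma mem_range_of_leading_term_add_mem [Algebra K F] [IsScalarTower K M F] {x : ℕ → F}
    (hx : AlgebraicIndependent M x) (y : M) {w : F} {N : ℕ}
    (hw : w ∈ Algebra.adjoin M (x '' Set.Iio N))
    (hyw : algebraMap M F y * x 0 ^ N * x N + w ∈ adjoin K (Set.range x)) :
    y ∈ (algebraMap K M).range := by
  have himg : x '' Set.Iio N = Set.range fun i : Fin N => x i := by
    ext a
    exact ⟨fun ⟨i, hi, ha⟩ => ⟨⟨i, hi⟩, ha⟩, fun ⟨i, ha⟩ => ⟨i, i.2, ha⟩⟩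
  rw [himg, Algebra.adjoin_range_eq_range_aeval] at hw
  obtain ⟨B, rfl⟩ := hw
  set m : ℕ →₀ ℕ := Finsupp.single 0 N + Finsupp.single N 1 with hm
  set S : MvPolynomial ℕ M := monomial m y + rename Fin.val B with hS
  have hSx : aeval x S = algebraMap M F y * x 0 ^ N * x N + aeval (fun i : Fin N => x i) B := by
    rw [hS, map_add, aeval_rename, aeval_monomial, hm,
      Finsupp.prod_add_index' (by simp) (fun _ _ _ => pow_add _ _ _)]
    simp only [Finsupp.prod_single_index, pow_zero, pow_one, mul_assoc, Function.comp_def]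
  obtain ⟨T, hT⟩ := mem_range_map_of_aeval_mem_adjoin (K := K) hx (hSx ▸ hyw)
  have hcoeff : coeff m S = y := by
    rw [hS, coeff_add, coeff_monomial, if_pos rfl, coeff_rename_eq_zero, add_zero]
    intro d hd
    have hdN := DFunLike.congr_fun hd N
    rw [Finsupp.mapDomain_of_notMem_range _ _ fun ⟨i, hi⟩ => i.2.ne hi] at hdN
    simp [hm] at hdN
  exact ⟨coeff m T, by rw [← hcoeff, ← hT, coeff_map]⟩

section Derivation

variable (δ : Derivation ℤ F F) (hM : ∀ c : M, δ (algebraMap M F c) ∈ (algebraMap M F).range)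
  (Ψ : F)

include hM

lemma derivation_mem_adjoin_image_Iio_succ {i : ℕ} {x : F}
    (hx : x ∈ Algebra.adjoin M ((fun j => δ^[j] Ψ) '' Set.Iio i)) :
    δ x ∈ Algebra.adjoin M ((fun j => δ^[j] Ψ) '' Set.Iio (i + 1)) := by
  refine derivation_mem_of_mem_algebraAdjoin δ (fun c => ?_) ?_ ?_ hx
  · obtain ⟨d, hd⟩ := hM c
    exact hd ▸ Subalgebra.algebraMap_mem _ d
  · rintro _ ⟨j, hj, rfl⟩
    exact Algebra.subset_adjoin ⟨j, Nat.lt_succ_of_lt hj, rfl⟩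
  · rintro _ ⟨j, hj, rfl⟩
    exact Algebra.subset_adjoin ⟨j + 1, Nat.succ_lt_succ hj, Function.iterate_succ_apply' δ j Ψ⟩

lemma iterate_smul_derivation_sub_mem_adjoin (y : M) (i : ℕ) :
    (Ψ • δ)^[i] (Ψ * algebraMap M F y) - algebraMap M F y * Ψ ^ i * δ^[i] Ψ ∈
      Algebra.adjoin M ((fun j => δ^[j] Ψ) '' Set.Iio i) := by
  induction i with
  | zero => simp [mul_comm]
  | succ i ih =>
    set A := Algebra.adjoin M ((fun j => δ^[j] Ψ) '' Set.Iio i)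
    set A' := Algebra.adjoin M ((fun j => δ^[j] Ψ) '' Set.Iio (i + 1))
    have hmem {j : ℕ} (hj : j < i + 1) : δ^[j] Ψ ∈ A' := Algebra.subset_adjoin ⟨j, hj, rfl⟩
    have hδ (x : F) (hx : x ∈ A) : δ x ∈ A' := derivation_mem_adjoin_image_Iio_succ δ hM Ψ hx
    have hΨ : Ψ ∈ A' := hmem i.succ_pos
    have hpow : δ (Ψ ^ i) ∈ A' := by
      rcases i.eq_zero_or_pos with rfl | hi
      · simp
      · exact hδ _ (A.pow_mem (Algebra.subset_adjoin ⟨0, hi, rfl⟩) i)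
    set z := (Ψ • δ)^[i] (Ψ * algebraMap M F y)
    set y' := algebraMap M F y
    have hstep : (Ψ • δ)^[i + 1] (Ψ * y') - y' * Ψ ^ (i + 1) * δ^[i + 1] Ψ =
        Ψ * (δ (z - y' * Ψ ^ i * δ^[i] Ψ) + (δ y' * Ψ ^ i + y' * δ (Ψ ^ i)) * δ^[i] Ψ) := by
      rw [Function.iterate_succ_apply', Function.iterate_succ_apply' δ i Ψ, map_sub]
      simp only [Derivation.leibniz, smul_eq_mul, Derivation.smul_apply, z]
      ring
    rw [hstep]
    exact A'.mul_mem hΨ (A'.add_mem (hδ _ ih) (A'.mul_mem (A'.add_mem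
      (A'.mul_mem (hδ _ (A.algebraMap_mem y)) (A'.pow_mem hΨ i))
      (A'.mul_mem (A'.algebraMap_mem y) hpow)) (hmem i.lt_succ_self)))

end Derivation

end LeadingTerm

/-! ### The equation `ρ Φ(y) = y + b` -/

/-- A derivation `δ` and an endomorphism `Φ` of an extension `F` of `K` that preserve `K` and obey
the chain rule `δ ∘ Φ = ρ (Φ ∘ δ)` with `ρ ∈ K` nonzero, where all the constants of `Φ` lie in `K`.
The examples are `d/dt` and `f ↦ f ∘ R` with `ρ = R'`, on `ℂ((t))` and on `ℂ((t))(log t)`. -/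
structure ChainRulePair (K F : Type*) [Field K] [Field F] [Algebra K F] where
  δ : Derivation ℤ F F
  Φ : F →+* F
  ρ : F
  δ_mem : ∀ k, δ (algebraMap K F k) ∈ (algebraMap K F).range
  Φ_mem : ∀ k, Φ (algebraMap K F k) ∈ (algebraMap K F).range
  ρ_mem : ρ ∈ (algebraMap K F).range
  ρ_ne_zero : ρ ≠ 0
  chain_rule : ∀ x, δ (Φ x) = ρ * Φ (δ x)
  mem_of_Φ_eq_self : ∀ x, Φ x = x → x ∈ (algebraMap K F).range

namespace ChainRulePair

open IntermediateField

variable {K F : Type*} [Field K] [Field F] [Algebra K F] (s : ChainRulePair K F) {Ψ : F}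

/-- The differential field `K⟨Ψ⟩` generated by `Ψ`. -/
noncomputable def differentialAdjoin (Ψ : F) : IntermediateField K F :=
  adjoin K (Set.range fun i => s.δ^[i] Ψ)

lemma iterate_mem_differentialAdjoin (Ψ : F) (i : ℕ) : s.δ^[i] Ψ ∈ s.differentialAdjoin Ψ :=
  subset_adjoin _ _ ⟨i, rfl⟩

lemma mem_differentialAdjoin_of_mem_range {x : F} (hx : x ∈ (algebraMap K F).range) :
    x ∈ s.differentialAdjoin Ψ := by
  obtain ⟨k, rfl⟩ := hx
  exact IntermediateField.algebraMap_mem _ k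

lemma δ_mem_differentialAdjoin {x : F} (hx : x ∈ s.differentialAdjoin Ψ) :
    s.δ x ∈ s.differentialAdjoin Ψ := by
  refine derivation_mem_of_mem_adjoin s.δ s.δ_mem (subset_adjoin _ _) ?_ hx
  rintro _ ⟨i, rfl⟩
  exact Function.iterate_succ_apply' s.δ i Ψ ▸ s.iterate_mem_differentialAdjoin Ψ (i + 1)

lemma smul_δ_iterate_mem_differentialAdjoin {x : F} (hx : x ∈ s.differentialAdjoin Ψ) (i : ℕ) :
    (Ψ • s.δ)^[i] x ∈ s.differentialAdjoin Ψ :=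
  iterate_mem (Ψ • s.δ) (fun _ hx => mul_mem (s.iterate_mem_differentialAdjoin Ψ 0)
    (s.δ_mem_differentialAdjoin hx)) hx i

lemma Φ_mem_differentialAdjoin (hΨ : s.Φ Ψ = s.ρ * Ψ) {x : F}
    (hx : x ∈ s.differentialAdjoin Ψ) : s.Φ x ∈ s.differentialAdjoin Ψ := by
  refine map_mem_of_mem_adjoin s.Φ_mem ?_ hx
  have hρ := s.mem_differentialAdjoin_of_mem_range (Ψ := Ψ) s.ρ_mem
  rintro _ ⟨i, rfl⟩
  induction i with
  | zero => exact hΨ ▸ mul_mem hρ (s.iterate_mem_differentialAdjoin Ψ 0)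
  | succ i ih =>
    have h := div_mem (s.δ_mem_differentialAdjoin ih) hρ
    rwa [s.chain_rule, mul_div_cancel_left₀ _ s.ρ_ne_zero,
      ← Function.iterate_succ_apply' s.δ] at h

lemma Φ_commute_smul_δ (hΨ : s.Φ Ψ = s.ρ * Ψ) : Function.Commute s.Φ ⇑(Ψ • s.δ) := fun x => by
  simp only [Derivation.smul_apply, smul_eq_mul, map_mul, hΨ, s.chain_rule]
  ring

lemma eq_zero_of_ρ_mul_Φ_eq_self (hΨ : s.Φ Ψ = s.ρ * Ψ) (htrans : Transcendental K Ψ) {w : F}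
    (hw : w ∈ (algebraMap K F).range) (hΦw : s.ρ * s.Φ w = w) : w = 0 := by
  by_contra hne
  obtain ⟨k, rfl⟩ := hw
  obtain ⟨l, hl⟩ := s.mem_of_Φ_eq_self (Ψ * algebraMap K F k) <| by
    rw [map_mul, hΨ]
    linear_combination Ψ * hΦw
  refine htrans ?_
  rw [eq_div_of_mul_eq hne hl.symm, ← map_div₀]
  exact isAlgebraic_algebraMap _

lemma not_algebraicIndependent_smul_δ_iterate {M : IntermediateField K F} (hfg : M.FG)
    (hM : ∀ x ∈ M, s.δ x ∈ M) {y : F} (hy : y ∈ M) :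
    ¬ AlgebraicIndependent (s.differentialAdjoin Ψ) fun i => (Ψ • s.δ)^[i] (Ψ * y) := by
  obtain ⟨S, hS⟩ := hfg
  set L := s.differentialAdjoin Ψ
  let E : IntermediateField L F := adjoin L (S : Set F)
  have hME : M ≤ E.restrictScalars K := hS ▸ adjoin_le_iff.mpr (subset_adjoin L (S : Set F))
  have hδS : ∀ a ∈ (S : Set F), s.δ a ∈ E := fun a ha => hME (hM a (hS ▸ subset_adjoin K _ ha))
  have hΨ : Ψ ∈ E := E.algebraMap_mem (⟨Ψ, s.iterate_mem_differentialAdjoin Ψ 0⟩ : L)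
  have hDE : ∀ x ∈ E, (Ψ • s.δ) x ∈ E := fun x hx => E.mul_mem hΨ <|
    derivation_mem_of_mem_adjoin s.δ (fun k => ⟨⟨_, s.δ_mem_differentialAdjoin k.2⟩, rfl⟩)
      (subset_adjoin L _) hδS hx
  have : Algebra.EssFiniteType L E := essFiniteType_iff.mpr (fg_adjoin_of_finite S.finite_toSet)
  exact not_algebraicIndependent_of_finTrdeg
    fun i => iterate_mem (Ψ • s.δ) hDE (E.mul_mem hΨ (hME hy)) i

lemma exists_iterate_add_sum_mem_differentialAdjoin [CharZero F] (hΨ : s.Φ Ψ = s.ρ * Ψ) {u b : F}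
    (hb : b ∈ s.differentialAdjoin Ψ) (hu : s.Φ u = u + b)
    (hdep : ¬ AlgebraicIndependent (s.differentialAdjoin Ψ) fun i => (Ψ • s.δ)^[i] u) :
    ∃ (N : ℕ) (c : ℕ → K), (Ψ • s.δ)^[N] u +
      ∑ i ∈ Finset.range N, c i • (Ψ • s.δ)^[i] u ∈ s.differentialAdjoin Ψ := by
  set L := s.differentialAdjoin Ψ
  set D := Ψ • s.δ
  let φ : L →+* L := (s.Φ.comp (algebraMap L F)).codRestrict L.toSubfield
    fun a => s.Φ_mem_differentialAdjoin hΨ a.2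
  have hφ (a : L) : s.Φ (algebraMap L F a) = algebraMap L F (φ a) := rfl
  have hDu (i : ℕ) : s.Φ (D^[i] u) = D^[i] u +
      algebraMap L F ⟨D^[i] b, s.smul_δ_iterate_mem_differentialAdjoin hb i⟩ := by
    rw [(s.Φ_commute_smul_δ hΨ).iterate_right i u, hu, iterate_map_add]
    rfl
  obtain ⟨c, hc, hcφ, g, hg⟩ := exists_linearCombination_mem_range hφ
    (fun a ha => ⟨⟨a, s.mem_differentialAdjoin_of_mem_range (s.mem_of_Φ_eq_self a ha)⟩, rfl⟩)
    hDu hdep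
  have hcK (i : ℕ) : ∃ k, algebraMap K F k = c i :=
    s.mem_of_Φ_eq_self _ ((hφ _).trans (congrArg _ (hcφ i)))
  choose k hk using hcK
  set N := c.support.max' (Finsupp.support_nonempty_iff.mpr hc)
  have hN : (c N : F) ≠ 0 :=
    (map_ne_zero (algebraMap L F)).mpr (Finsupp.mem_support_iff.mp (c.support.max'_mem _))
  have hsum : algebraMap L F g = c N * (D^[N] u + ∑ i ∈ Finset.range N, (k i / k N) • D^[i] u) := by
    have hsupp : c.support ⊆ Finset.range (N + 1) := fun i hi =>
      Finset.mem_range_succ_iff.mpr (c.support.le_max' i hi)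
    rw [hg, Finsupp.linearCombination_apply, Finsupp.sum_of_support_subset _ hsupp _ (by simp),
      Finset.sum_range_succ, add_comm, mul_add, Finset.mul_sum]
    simp only [Algebra.smul_def, IntermediateField.algebraMap_apply, map_div₀, hk, ← mul_assoc,
      mul_div_cancel₀ _ hN]
  refine ⟨N, fun i => k i / k N, ?_⟩
  rw [← mul_div_cancel_left₀ (D^[N] u + _) hN, ← hsum]
  exact div_mem g.2 (c N).2

theorem mem_range_of_ρ_mul_Φ_eq_add [CharZero F] (hΨ : s.Φ Ψ = s.ρ * Ψ)
    (hind : AlgebraicIndependent K fun i => s.δ^[i] Ψ) {M : IntermediateField K F} (hfg : M.FG)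
    (hM : ∀ x ∈ M, s.δ x ∈ M) {y b : F} (hy : y ∈ M) (hb : b ∈ (algebraMap K F).range)
    (hyb : s.ρ * s.Φ y = y + b) : y ∈ (algebraMap K F).range := by
  have hu : s.Φ (Ψ * y) = Ψ * y + Ψ * b := by
    rw [map_mul, hΨ]
    linear_combination Ψ * hyb
  obtain ⟨N, c, hN⟩ := s.exists_iterate_add_sum_mem_differentialAdjoin hΨ
    (mul_mem (s.iterate_mem_differentialAdjoin Ψ 0) (s.mem_differentialAdjoin_of_mem_range hb))
    hu (s.not_algebraicIndependent_smul_δ_iterate hfg hM hy)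
  lift y to M using hy
  set x : ℕ → F := fun i => s.δ^[i] Ψ
  set D := Ψ • s.δ
  set A := Algebra.adjoin M (x '' Set.Iio N)
  have hxA {i : ℕ} (hi : i < N) : x i ∈ A := Algebra.subset_adjoin ⟨i, hi, rfl⟩
  have hlead (i : ℕ) := iterate_smul_derivation_sub_mem_adjoin s.δ
    (fun k : M => ⟨⟨_, hM _ k.2⟩, rfl⟩) Ψ y i
  have hDA {i : ℕ} (hi : i < N) : D^[i] (Ψ * y) ∈ A := by
    have hsub := Algebra.adjoin_mono (R := M) (Set.image_mono (f := x) (Set.Iio_subset_Iio hi.le))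
      (hlead i)
    have htop : (y : F) * Ψ ^ i * s.δ^[i] Ψ ∈ A :=
      A.mul_mem (A.mul_mem (A.algebraMap_mem y) (A.pow_mem (hxA (Nat.zero_lt_of_lt hi)) i)) (hxA hi)
    exact sub_add_cancel (D^[i] (Ψ * (y : F))) _ ▸ A.add_mem hsub htop
  have hrest : D^[N] (Ψ * y) - y * Ψ ^ N * s.δ^[N] Ψ +
      ∑ i ∈ Finset.range N, c i • D^[i] (Ψ * y) ∈ A :=
    A.add_mem (hlead N) (A.sum_mem fun i hi => by
      rw [← algebraMap_smul M (c i)]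
      exact A.smul_mem (hDA (Finset.mem_range.mp hi)) _)
  obtain ⟨k, hk⟩ := mem_range_of_leading_term_add_mem (K := K)
    (algebraicIndependent_iterate_of_fg s.δ hind hfg hM) y hrest (by
      change _ ∈ s.differentialAdjoin Ψ
      convert hN using 1
      change (y : F) * Ψ ^ N * _ + _ = _
      ring)
  exact ⟨k, congrArg Subtype.val hk⟩

end ChainRulePair

/-! ### Derivations and endomorphisms of fields of rational functions -/

section RatFunc

open Polynomial

/-- The derivations of a field `F`. The abbreviation makes the `ℤ`-algebra structure of `F` the one
of a general ring: on `RatFunc L` and on `ℂ⸨X⸩` instance search would find another one. -/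
abbrev FieldDerivation (F : Type*) [Field F] : Type _ := Derivation ℤ F F

lemma derivation_mul {F : Type*} [Field F] (δ : FieldDerivation F) (f g : F) :
    δ (f * g) = f * δ g + g * δ f :=
  δ.leibniz f g

/-- An additive self-map of a field satisfying the Leibniz rule, bundled as a derivation. -/
noncomputable def derivationOfLeibniz {F : Type*} [Field F] (d : F → F)
    (hadd : ∀ f g, d (f + g) = d f + d g) (hmul : ∀ f g, d (f * g) = f * d g + g * d f) :
    FieldDerivation F :=
  Derivation.mk' (AddMonoidHom.mk' d hadd).toIntLinearMap hmul

/-- The subfield on which the chain rule `δ' ∘ Φ = ρ (Φ ∘ δ)` holds. A chain rule need therefore be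
checked only on field generators. -/
noncomputable def chainRuleSubfield {E F : Type*} [Field E] [Field F] (δ : FieldDerivation E)
    (δ' : FieldDerivation F) (Φ : E →+* F) (ρ : F) : Subfield E where
  carrier := {f | δ' (Φ f) = ρ * Φ (δ f)}
  zero_mem' := by simp
  one_mem' := by simp
  add_mem' {f g} hf hg := by
    simp_all only [Set.mem_ofPred_eq, map_add, mul_add]
  neg_mem' {f} hf := by
    simp_all only [Set.mem_ofPred_eq, map_neg, mul_neg]
  mul_mem' {f g} hf hg := by
    simp_all only [Set.mem_ofPred_eq, map_mul, Derivation.leibniz, smul_eq_mul, map_add]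
    ring
  inv_mem' f hf := by
    simp_all only [Set.mem_ofPred_eq, map_inv₀, Derivation.leibniz_inv, smul_eq_mul, map_mul,
      map_neg, map_pow]
    ring

variable {L : Type*} [Field L]

lemma mem_of_C_mem_of_X_mem {E : Subfield (RatFunc L)} (hC : ∀ a, RatFunc.C a ∈ E)
    (hX : RatFunc.X ∈ E) (f : RatFunc L) : f ∈ E := by
  have hle : IntermediateField.adjoin L {(RatFunc.X : RatFunc L)} ≤ E.toIntermediateField hC :=
    IntermediateField.adjoin_simple_le_iff.mpr hX
  rw [RatFunc.adjoin_X] at hle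
  exact hle trivial

section Derivation

variable (D : FieldDerivation L) (w : L)

/-- `polyDeriv` bundled as a derivation. -/
noncomputable def polyDerivation : Derivation ℤ L[X] L[X] :=
  letI : Differential L := ⟨D⟩
  Differential.implicitDeriv (C w)

lemma polyDerivation_apply (p : L[X]) : polyDerivation D w p = polyDeriv D w p := by
  let : Differential L := ⟨D⟩
  have hmap : Differential.mapCoeffs p = p.sum fun n c => monomial n (D c) := by
    ext n
    have hcoeff : (Differential.mapCoeffs p).coeff n = D (p.coeff n) :=
      Differential.coeff_mapCoeffs p n
    rw [hcoeff, sum_def, finsetSum_coeff]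
    simp +contextual [coeff_monomial]
  rw [polyDeriv, ← hmap]
  simp [polyDerivation, Differential.implicitDeriv, derivative'_apply]

lemma polyDeriv_C (a : L) : polyDeriv D w (C a) = C (D a) := by
  simp [polyDeriv]

lemma polyDeriv_X : polyDeriv D w (X : L[X]) = C w := by
  simp [polyDeriv, sum_X_index]

lemma ratFuncDeriv_div (p : L[X]) {q : L[X]} (hq : q ≠ 0) :
    ratFuncDeriv D w (algebraMap L[X] (RatFunc L) p / algebraMap L[X] (RatFunc L) q) =
      algebraMap L[X] (RatFunc L) (polyDeriv D w p * q - p * polyDeriv D w q) /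
        algebraMap L[X] (RatFunc L) q ^ 2 := by
  generalize hf : algebraMap L[X] (RatFunc L) p / algebraMap L[X] (RatFunc L) q = f
  have hq' : algebraMap L[X] (RatFunc L) q ≠ 0 := RatFunc.algebraMap_ne_zero hq
  have hd' : algebraMap L[X] (RatFunc L) f.denom ≠ 0 := RatFunc.algebraMap_ne_zero f.denom_ne_zero
  have hpq : p * f.denom = f.num * q := by
    have h := hf.trans (RatFunc.num_div_denom f).symm
    rw [div_eq_div_iff hq' hd', ← map_mul, ← map_mul] at h
    exact RatFunc.algebraMap_injective L h
  have hderiv := congrArg (polyDerivation D w) hpq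
  simp only [Derivation.leibniz, smul_eq_mul, polyDerivation_apply] at hderiv
  have hquot : (polyDeriv D w f.num * f.denom - f.num * polyDeriv D w f.denom) * q ^ 2 =
      (polyDeriv D w p * q - p * polyDeriv D w q) * f.denom ^ 2 := by
    linear_combination (-f.denom * q) * hderiv +
      (polyDeriv D w f.denom * q + f.denom * polyDeriv D w q) * hpq
  have hquot' := congrArg (algebraMap L[X] (RatFunc L)) hquot
  rw [ratFuncDeriv, map_pow, div_eq_div_iff (pow_ne_zero 2 hd') (pow_ne_zero 2 hq'), ← map_sub]
  simpa only [map_mul, map_pow] using hquot'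

lemma ratFuncDeriv_add (f g : RatFunc L) :
    ratFuncDeriv D w (f + g) = ratFuncDeriv D w f + ratFuncDeriv D w g := by
  induction f using RatFunc.induction_on with
  | _ p q hq =>
  induction g using RatFunc.induction_on with
  | _ r s hs =>
  have hq' : algebraMap L[X] (RatFunc L) q ≠ 0 := RatFunc.algebraMap_ne_zero hq
  have hs' : algebraMap L[X] (RatFunc L) s ≠ 0 := RatFunc.algebraMap_ne_zero hs
  rw [div_add_div _ _ hq' hs', ← map_mul, ← map_mul, ← map_mul, ← map_add,
    ratFuncDeriv_div D w _ (mul_ne_zero hq hs), ratFuncDeriv_div D w _ hq,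
    ratFuncDeriv_div D w _ hs]
  simp only [← polyDerivation_apply, Derivation.leibniz, smul_eq_mul, map_mul, map_add, map_sub]
  field_simp
  ring

lemma ratFuncDeriv_mul (f g : RatFunc L) :
    ratFuncDeriv D w (f * g) = f * ratFuncDeriv D w g + g * ratFuncDeriv D w f := by
  induction f using RatFunc.induction_on with
  | _ p q hq =>
  induction g using RatFunc.induction_on with
  | _ r s hs =>
  have hq' : algebraMap L[X] (RatFunc L) q ≠ 0 := RatFunc.algebraMap_ne_zero hq
  have hs' : algebraMap L[X] (RatFunc L) s ≠ 0 := RatFunc.algebraMap_ne_zero hs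
  rw [div_mul_div_comm, ← map_mul, ← map_mul, ratFuncDeriv_div D w _ (mul_ne_zero hq hs),
    ratFuncDeriv_div D w _ hq, ratFuncDeriv_div D w _ hs]
  simp only [← polyDerivation_apply, Derivation.leibniz, smul_eq_mul, map_mul, map_add, map_sub]
  field_simp
  ring

/-- `ratFuncDeriv` bundled as a derivation. -/
noncomputable def ratFuncDerivation : FieldDerivation (RatFunc L) :=
  derivationOfLeibniz (ratFuncDeriv D w) (ratFuncDeriv_add D w) (ratFuncDeriv_mul D w)

lemma ratFuncDerivation_algebraMap (p : L[X]) :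
    ratFuncDerivation D w (algebraMap L[X] (RatFunc L) p) =
      algebraMap L[X] (RatFunc L) (polyDeriv D w p) := by
  change ratFuncDeriv D w _ = _
  have h := ratFuncDeriv_div D w p one_ne_zero
  rw [← polyDerivation_apply D w 1, Derivation.map_one_eq_zero] at h
  simpa using h

@[simp] lemma ratFuncDerivation_C (a : L) :
    ratFuncDerivation D w (RatFunc.C a) = RatFunc.C (D a) := by
  rw [← RatFunc.algebraMap_C, ratFuncDerivation_algebraMap, polyDeriv_C, RatFunc.algebraMap_C]

@[simp] lemma ratFuncDerivation_X :
    ratFuncDerivation D w (RatFunc.X : RatFunc L) = RatFunc.C w := by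
  rw [← RatFunc.algebraMap_X, ratFuncDerivation_algebraMap, polyDeriv_X, RatFunc.algebraMap_C]

variable {D w}

lemma ratFuncDerivation_chain_rule {F : Type*} [Field F] {δ : FieldDerivation F}
    {Φ : RatFunc L →+* F} {ρ : F} (hC : ∀ a, δ (Φ (RatFunc.C a)) = ρ * Φ (RatFunc.C (D a)))
    (hX : δ (Φ RatFunc.X) = ρ * Φ (RatFunc.C w)) (f : RatFunc L) :
    δ (Φ f) = ρ * Φ (ratFuncDerivation D w f) := by
  refine mem_of_C_mem_of_X_mem (E := chainRuleSubfield (ratFuncDerivation D w) δ Φ ρ)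
    (fun a => ?_) ?_ f
  · exact (hC a).trans (by rw [ratFuncDerivation_C])
  · exact hX.trans (by rw [ratFuncDerivation_X])

end Derivation

/-- The endomorphism of `L[T]` that extends `φ` and sends `T` to `c T + u`. -/
noncomputable def polyHom (φ : L →+* L) (c u : L) : L[X] →+* L[X] :=
  eval₂RingHom (C.comp φ) (C c * X + C u)

lemma polyHom_apply (φ : L →+* L) (c u : L) (p : L[X]) :
    polyHom φ c u p = (p.map φ).comp (C c * X + C u) := by
  simp [polyHom, Polynomial.comp, eval₂_map]

@[simp] lemma polyHom_C (φ : L →+* L) (c u a : L) : polyHom φ c u (C a) = C (φ a) := by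
  simp [polyHom_apply]

@[simp] lemma polyHom_X (φ : L →+* L) (c u : L) : polyHom φ c u X = C c * X + C u := by
  simp [polyHom_apply]

variable {φ : L →+* L} {c u : L} (hc : c ≠ 0)

lemma ratFuncHom_algebraMap (p : L[X]) :
    ratFuncHom φ c u hc (algebraMap L[X] (RatFunc L) p) =
      algebraMap L[X] (RatFunc L) (polyHom φ c u p) := by
  simpa [ratFuncHom, RatFunc.coe_mapRingHom_eq_coe_map, polyHom] using
    RatFunc.map_apply_div (polyHom φ c u)
      (nonZeroDivisors_le_comap_nonZeroDivisors_of_injective _ (eval₂_linear_injective φ c u hc))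
      p 1

@[simp] lemma ratFuncHom_C (a : L) : ratFuncHom φ c u hc (RatFunc.C a) = RatFunc.C (φ a) := by
  rw [← RatFunc.algebraMap_C, ratFuncHom_algebraMap]
  simp

@[simp] lemma ratFuncHom_X :
    ratFuncHom φ c u hc RatFunc.X = RatFunc.C c * RatFunc.X + RatFunc.C u := by
  rw [← RatFunc.algebraMap_X, ratFuncHom_algebraMap]
  simp

end RatFunc

/-! ### The field `ℂ((t))` and its subfield `ℂ(t)` -/

section Laurent

open HahnSeries

lemma ddt_coeff (f : ℂ⸨X⸩) (n : ℤ) : (ddt f).coeff n = (n + 1) * f.coeff (n + 1) := by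
  rw [ddt, LaurentSeries.derivative_apply, LaurentSeries.hasseDeriv_coeff]
  simp

lemma ddt_ofPowerSeries (p : ℂ⟦X⟧) :
    ddt (ofPowerSeries ℤ ℂ p) = ofPowerSeries ℤ ℂ (PowerSeries.derivative ℂ p) := by
  ext n
  rw [ddt_coeff, PowerSeries.coeff_coe, PowerSeries.coeff_coe]
  obtain hn | rfl | hn : n < -1 ∨ n = -1 ∨ 0 ≤ n := by omega
  · rw [if_pos (by omega), if_pos (by omega), mul_zero]
  · simp
  · rw [if_neg (by omega), if_neg (by omega), PowerSeries.coeff_derivative]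
    lift n to ℕ using hn
    norm_cast
    rw [mul_comm]

lemma ddt_single_mul (n : ℤ) (f : ℂ⸨X⸩) :
    ddt (single n 1 * f) = single n 1 * (single (-1) (n : ℂ) * f + ddt f) := by
  have hsingle : (single n 1 * single (-1) (n : ℂ) : ℂ⸨X⸩) = single (n - 1) (n : ℂ) := by
    rw [single_mul_single, one_mul, sub_eq_add_neg]
  rw [mul_add, ← mul_assoc, hsingle]
  ext k
  have h₁ := coeff_single_mul_add (r := (1 : ℂ)) (x := f) (a := k + 1 - n) (b := n)
  have h₂ := coeff_single_mul_add (r := (n : ℂ)) (x := f) (a := k + 1 - n) (b := n - 1)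
  have h₃ := coeff_single_mul_add (r := (1 : ℂ)) (x := ddt f) (a := k - n) (b := n)
  rw [show k + 1 - n + n = k + 1 by ring] at h₁
  rw [show k + 1 - n + (n - 1) = k by ring] at h₂
  rw [show k - n + n = k by ring] at h₃
  rw [ddt_coeff, coeff_add, h₁, h₂, h₃, ddt_coeff, show k - n + 1 = k + 1 - n by ring]
  push_cast
  ring

lemma ddt_mul (f g : ℂ⸨X⸩) : ddt (f * g) = f * ddt g + g * ddt f := by
  obtain ⟨n, p, rfl⟩ : ∃ (n : ℤ) (p : ℂ⟦X⟧), f = single n 1 * ofPowerSeries ℤ ℂ p :=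
    ⟨_, _, (LaurentSeries.single_order_mul_powerSeriesPart f).symm⟩
  obtain ⟨m, q, rfl⟩ : ∃ (m : ℤ) (q : ℂ⟦X⟧), g = single m 1 * ofPowerSeries ℤ ℂ q :=
    ⟨_, _, (LaurentSeries.single_order_mul_powerSeriesPart g).symm⟩
  have hmul : single n 1 * ofPowerSeries ℤ ℂ p * (single m 1 * ofPowerSeries ℤ ℂ q) =
      single (n + m) 1 * ofPowerSeries ℤ ℂ (p * q) := by
    rw [map_mul, mul_mul_mul_comm, single_mul_single, one_mul]
  have hadd : (single (-1) ((n + m : ℤ) : ℂ) : ℂ⸨X⸩) =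
      single (-1) (n : ℂ) + single (-1) (m : ℂ) := by
    rw [Int.cast_add, single_add]
  have hone : (single (n + m) 1 : ℂ⸨X⸩) = single n 1 * single m 1 := by
    rw [single_mul_single, one_mul]
  rw [hmul, ddt_single_mul, ddt_single_mul, ddt_single_mul, ddt_ofPowerSeries, ddt_ofPowerSeries,
    ddt_ofPowerSeries, Derivation.leibniz, hadd, hone]
  simp only [smul_eq_mul, map_mul, map_add]
  ring

/-- `ddt` bundled as a derivation. -/
noncomputable def ddtDerivation : FieldDerivation ℂ⸨X⸩ :=
  derivationOfLeibniz ddt (map_add _) ddt_mul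

@[simp] lemma coe_ddtDerivation : ⇑ddtDerivation = ddt := rfl

lemma ddt_C (c : ℂ) : ddt (C c) = 0 := by
  rw [← PowerSeries.coe_C, ddt_ofPowerSeries]
  simp

lemma eq_C_of_ddt_eq_zero {f : ℂ⸨X⸩} (hf : ddt f = 0) : f = C (f.coeff 0) := by
  ext n
  rcases eq_or_ne n 0 with rfl | hn
  · simp [C_apply]
  · have h := ddt_coeff f (n - 1)
    simp only [hf, coeff_zero, sub_add_cancel] at h
    push_cast at h
    rw [sub_add_cancel, eq_comm, mul_eq_zero] at h
    rw [C_apply, coeff_single_of_ne hn]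
    exact h.resolve_left (Int.cast_ne_zero.mpr hn)

@[simp] lemma expansion_C (c : ℂ) : expansion (RatFunc.C c) = C c := by
  rw [expansion, ← RatFunc.algebraMap_C]
  have h := RatFunc.coe_coe (Polynomial.C c)
  simp only [Polynomial.coe_C, PowerSeries.coe_C] at h
  exact h.symm

@[simp] lemma expansion_X : expansion RatFunc.X = ofPowerSeries ℤ ℂ PowerSeries.X := by
  rw [PowerSeries.coe_X]
  exact RatFunc.coe_X

/-- The derivation `d/dt` of `ℂ(t)`. -/
noncomputable def ratDeriv : FieldDerivation (RatFunc ℂ) := ratFuncDerivation 0 1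

@[simp] lemma ratDeriv_C (c : ℂ) : ratDeriv (RatFunc.C c) = 0 := by simp [ratDeriv]

@[simp] lemma ratDeriv_X : ratDeriv RatFunc.X = 1 := by simp [ratDeriv]

lemma ddt_expansion (f : RatFunc ℂ) : ddt (expansion f) = expansion (ratDeriv f) := by
  have h := ratFuncDerivation_chain_rule (D := 0) (w := 1) (δ := ddtDerivation) (Φ := expansion)
    (ρ := 1) (fun a => by simp [ddt_C, -C_apply]) (by
      rw [expansion_X, coe_ddtDerivation, ddt_ofPowerSeries]
      simp) f
  rwa [one_mul] at h

end Laurent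

/-! ### The endomorphism `Φ_R` -/

section Phi

open HahnSeries

variable {R : ℂ⟦X⟧} (h0 : PowerSeries.constantCoeff R = 0) (hR : R ≠ 0)

lemma Phi_ofPowerSeries (p : ℂ⟦X⟧) :
    Phi R h0 hR (ofPowerSeries ℤ ℂ p) = ofPowerSeries ℤ ℂ (PowerSeries.subst R p) := by
  have h := IsLocalization.Away.lift_eq (S := ℂ⸨X⸩) (PowerSeries.X : ℂ⟦X⟧)
    (isUnit_subst_X R h0 hR) p
  rw [LaurentSeries.coe_algebraMap] at h
  rw [Phi, h, ← PowerSeries.coe_substAlgHom (PowerSeries.HasSubst.of_constantCoeff_zero' h0)]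
  rfl

@[simp] lemma Phi_C (c : ℂ) : Phi R h0 hR (C c) = C c := by
  rw [← PowerSeries.coe_C, Phi_ofPowerSeries, PowerSeries.subst_C]
  rfl

lemma ddt_Phi (f : ℂ⸨X⸩) : ddt (Phi R h0 hR f) =
    ofPowerSeries ℤ ℂ (PowerSeries.derivative ℂ R) * Phi R h0 hR (ddt f) := by
  set E := chainRuleSubfield ddtDerivation ddtDerivation (Phi R h0 hR)
    (ofPowerSeries ℤ ℂ (PowerSeries.derivative ℂ R))
  have hE (p : ℂ⟦X⟧) : ofPowerSeries ℤ ℂ p ∈ E := by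
    change ddt (Phi R h0 hR _) = _ * Phi R h0 hR (ddt _)
    rw [Phi_ofPowerSeries, ddt_ofPowerSeries, ddt_ofPowerSeries, Phi_ofPowerSeries,
      PowerSeries.derivative_subst (PowerSeries.HasSubst.of_constantCoeff_zero' h0), map_mul,
      mul_comm]
  obtain ⟨p, q, -, rfl⟩ := IsFractionRing.div_surjective (A := ℂ⟦X⟧) f
  exact E.div_mem (hE p) (hE q)

lemma Phi_expansion_mem_range (hrat : ofPowerSeries ℤ ℂ R ∈ expansion.range) (f : RatFunc ℂ) :
    Phi R h0 hR (expansion f) ∈ expansion.range := by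
  refine mem_of_C_mem_of_X_mem (E := expansion.fieldRange.comap ((Phi R h0 hR).comp expansion))
    (fun a => ⟨RatFunc.C a, by simp [-C_apply]⟩) ?_ f
  change Phi R h0 hR (expansion RatFunc.X) ∈ expansion.range
  rwa [expansion_X, Phi_ofPowerSeries,
    PowerSeries.subst_X (PowerSeries.HasSubst.of_constantCoeff_zero' h0)]

include h0 hR in
lemma derivative_ne_zero_of_constantCoeff_eq_zero : PowerSeries.derivative ℂ R ≠ 0 := fun h =>
  hR (PowerSeries.derivative.ext (R := ℂ) (by rw [h, map_zero]) (by rw [h0, map_zero]))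

lemma derivative_mem_range (hrat : ofPowerSeries ℤ ℂ R ∈ expansion.range) :
    ofPowerSeries ℤ ℂ (PowerSeries.derivative ℂ R) ∈ expansion.range := by
  obtain ⟨r, hr⟩ := hrat
  exact ⟨ratDeriv r, by rw [← ddt_expansion, hr, ddt_ofPowerSeries]⟩

end Phi

/-! ### The fixed field of `Φ_R` in `ℂ((t))` -/

section Subst

open PowerSeries

variable {k : Type*} [Field k] {R : k⟦X⟧}

lemma constantCoeff_subst_of_constantCoeff_eq_zero (h0 : constantCoeff R = 0) (p : k⟦X⟧) :
    constantCoeff (subst R p) = constantCoeff p := by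
  have hs := HasSubst.of_constantCoeff_zero' h0
  obtain ⟨q, hq⟩ : X ∣ p - C (constantCoeff p) := X_dvd_iff.mpr (by simp)
  rw [sub_eq_iff_eq_add'] at hq
  conv_lhs => rw [hq, subst_add hs, subst_mul hs, subst_X hs, subst_C]
  rw [map_add, map_mul, h0, zero_mul, add_zero]
  exact constantCoeff_C _

lemma coeff_one_X_mul (p : k⟦X⟧) : coeff 1 (X * p) = constantCoeff p :=
  (coeff_succ_X_mul 0 p).trans (coeff_zero_eq_constantCoeff_apply p)

lemma associated_X_pow_order {p : k⟦X⟧} (hp : p ≠ 0) : Associated (X ^ p.order.toNat) p :=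
  ⟨(isUnit_divided_by_X_pow_order hp).unit, X_pow_order_mul_divXPowOrder⟩

lemma toNat_order_ne_zero {p : k⟦X⟧} (hp : p ≠ 0) (hp0 : constantCoeff p = 0) :
    p.order.toNat ≠ 0 := fun h =>
  coeff_order hp (by rwa [h, coeff_zero_eq_constantCoeff])

lemma pow_mul_subst_eq_C_mul {r u : k⟦X⟧} {m : ℕ} {c : k} (h0 : constantCoeff (X * r) = 0)
    (h : subst (X * r) (X ^ m * u) = C c * (X ^ m * u)) : r ^ m * subst (X * r) u = C c * u := by
  have hs := HasSubst.of_constantCoeff_zero' h0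
  rw [subst_mul hs, subst_pow hs, subst_X hs, mul_pow, mul_assoc, mul_left_comm (C c)] at h
  exact mul_left_cancel₀ (pow_ne_zero m X_ne_zero) h

lemma coeff_one_pow_order_eq_of_subst_eq_C_mul (h0 : constantCoeff R = 0) {p : k⟦X⟧} (hp : p ≠ 0)
    {c : k} (h : subst R p = C c * p) : coeff 1 R ^ p.order.toNat = c := by
  obtain ⟨r, rfl⟩ : X ∣ R := X_dvd_iff.mpr h0
  rw [← X_pow_order_mul_divXPowOrder (f := p)] at h
  have hconst := congrArg constantCoeff (pow_mul_subst_eq_C_mul h0 h)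
  rw [map_mul, map_pow, constantCoeff_subst_of_constantCoeff_eq_zero h0, map_mul,
    constantCoeff_C] at hconst
  rw [coeff_one_X_mul]
  exact mul_right_cancel₀ (mt constantCoeff_divXPowOrder_eq_zero_iff.mp hp) hconst

lemma sub_X_dvd_subst_sub (h0 : constantCoeff R = 0) (p : k⟦X⟧) : R - X ∣ subst R p - p := by
  have hs := HasSubst.of_constantCoeff_zero' h0
  rcases eq_or_ne (R - X) 0 with hRX | hRX
  · simp [sub_eq_zero.mp hRX, X_subst]
  have hassoc := associated_X_pow_order hRX
  generalize (R - X).order.toNat = n at hassoc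
  refine hassoc.symm.dvd.trans ?_
  have hpoly (q : Polynomial k) : R - X ∣ subst R (q : k⟦X⟧) - q := by
    have h := Polynomial.sub_dvd_eval_sub R X (q.map (algebraMap k k⟦X⟧))
    rw [Polynomial.eval_map_algebraMap, Polynomial.eval_map_algebraMap, ← subst_coe hs,
      ← subst_coe HasSubst.X', X_subst] at h
    exact h
  rw [eq_X_pow_mul_shift_add_trunc n p, subst_add hs, add_sub_add_comm]
  refine dvd_add (dvd_sub ?_ (dvd_mul_right _ _)) (hassoc.dvd.trans (hpoly _))
  rw [subst_mul hs, subst_pow hs, subst_X hs]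
  exact (pow_dvd_pow_of_dvd (X_dvd_iff.mpr h0) n).mul_right _

lemma eq_X_of_subst_eq_self [CharZero k] (h0 : constantCoeff R = 0) (h1 : coeff 1 R = 1)
    {p : k⟦X⟧} (hp : p ≠ 0) (hp0 : constantCoeff p = 0) (h : subst R p = p) : R = X := by
  obtain ⟨r, rfl⟩ : X ∣ R := X_dvd_iff.mpr h0
  rw [coeff_one_X_mul] at h1
  have hm := toNat_order_ne_zero hp hp0
  have hu := isUnit_divided_by_X_pow_order hp
  have hpu : X ^ p.order.toNat * divXPowOrder p = p := X_pow_order_mul_divXPowOrder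
  generalize p.order.toNat = m, divXPowOrder p = u at hm hu hpu
  have hru : r ^ m * subst (X * r) u = u := by
    simpa using pow_mul_subst_eq_C_mul (c := 1) h0 (by rwa [hpu, map_one, one_mul])
  have hgeom : (r ^ m - 1) * u = (r - 1) * ((∑ i ∈ Finset.range m, r ^ i) * u) := by
    rw [← geom_sum_mul]
    ring
  have hdvd : (r - 1) * X ∣ (r - 1) * ((∑ i ∈ Finset.range m, r ^ i) * u) := by
    rw [← hgeom, show (r - 1) * X = X * r - X by ring,
      show (r ^ m - 1) * u = r ^ m * -(subst (X * r) u - u) by linear_combination hru]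
    exact ((sub_X_dvd_subst_sub h0 u).neg_right).mul_left _
  by_contra hne
  have hr : r - 1 ≠ 0 := fun hr => hne (by rw [sub_eq_zero.mp hr, mul_one])
  have hX := (hu.dvd_mul_right).mp ((mul_dvd_mul_iff_left hr).mp hdvd)
  rw [X_dvd_iff, map_sum] at hX
  simp [h1, hm] at hX

lemma coeff_one_subst (h0 : constantCoeff R = 0) {p : k⟦X⟧} (hp : constantCoeff p = 0) :
    coeff 1 (subst R p) = coeff 1 p * coeff 1 R := by
  have hs := HasSubst.of_constantCoeff_zero' h0
  obtain ⟨q, rfl⟩ : X ∣ p := X_dvd_iff.mpr hp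
  obtain ⟨r, rfl⟩ : X ∣ R := X_dvd_iff.mpr h0
  rw [subst_mul hs, subst_X hs, mul_assoc, coeff_one_X_mul, coeff_one_X_mul, coeff_one_X_mul,
    map_mul, constantCoeff_subst_of_constantCoeff_eq_zero h0, mul_comm]

lemma eq_zero_of_subst_eq_self_of_coeff_one_eq_zero (h0 : constantCoeff R = 0)
    (h1 : coeff 1 R = 0) {p : k⟦X⟧} (hp0 : constantCoeff p = 0) (h : subst R p = p) : p = 0 := by
  by_contra hp
  have hpow := coeff_one_pow_order_eq_of_subst_eq_C_mul (c := 1) h0 hp (by rwa [map_one, one_mul])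
  rw [h1, zero_pow (toNat_order_ne_zero hp hp0)] at hpow
  exact zero_ne_one hpow

end Subst

section Iterate

open PowerSeries

variable {R : ℂ⟦X⟧}

lemma constantCoeff_iter (h0 : constantCoeff R = 0) (n : ℕ) : constantCoeff (iter R n) = 0 := by
  induction n with
  | zero => exact constantCoeff_X
  | succ n ih => rw [iter, constantCoeff_subst_of_constantCoeff_eq_zero h0, ih]

lemma coeff_one_iter (h0 : constantCoeff R = 0) (n : ℕ) :
    coeff 1 (iter R n) = coeff 1 R ^ n := by
  induction n with
  | zero => simp [iter]
  | succ n ih => rw [iter, coeff_one_subst h0 (constantCoeff_iter h0 n), ih, pow_succ]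

lemma subst_iter_eq_self (h0 : constantCoeff R = 0) {p : ℂ⟦X⟧} (h : subst R p = p) (n : ℕ) :
    subst (iter R n) p = p := by
  induction n with
  | zero => exact X_subst p
  | succ n ih =>
    rw [iter, ← subst_comp_subst_apply (HasSubst.of_constantCoeff_zero' (constantCoeff_iter h0 n))
      (HasSubst.of_constantCoeff_zero' h0), ih, h]

lemma eq_zero_of_subst_eq_self_of_iter_ne (h0 : constantCoeff R = 0)
    (hiter : ∀ n, 0 < n → iter R n ≠ X) {p : ℂ⟦X⟧} (hp0 : constantCoeff p = 0)
    (h : subst R p = p) : p = 0 := by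
  by_contra hp
  have hroot : coeff 1 R ^ p.order.toNat = 1 :=
    coeff_one_pow_order_eq_of_subst_eq_C_mul h0 hp (by rwa [map_one, one_mul])
  refine hiter _ (Nat.pos_of_ne_zero (toNat_order_ne_zero hp hp0))
    (eq_X_of_subst_eq_self (constantCoeff_iter h0 _) ?_ hp hp0 (subst_iter_eq_self h0 h _))
  rw [coeff_one_iter h0, hroot]

end Iterate

section FixedField

open PowerSeries

variable {R : ℂ⟦X⟧} (h0 : constantCoeff R = 0) (hR : R ≠ 0)

lemma exists_eq_ofPowerSeries_or_inv_eq (f : ℂ⸨X⸩) :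
    ∃ p : ℂ⟦X⟧, f = HahnSeries.ofPowerSeries ℤ ℂ p ∨ f⁻¹ = HahnSeries.ofPowerSeries ℤ ℂ p := by
  obtain ⟨p, hp⟩ | ⟨p, hp⟩ := ValuationRing.isInteger_or_isInteger ℂ⟦X⟧ f
  · exact ⟨p, .inl hp.symm⟩
  · exact ⟨p, .inr hp.symm⟩

lemma exists_eq_C_of_Phi_eq_self
    (hfix : ∀ p : ℂ⟦X⟧, constantCoeff p = 0 → subst R p = p → p = 0) {f : ℂ⸨X⸩}
    (hf : Phi R h0 hR f = f) : ∃ a, f = HahnSeries.C a := by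
  have hseries (p : ℂ⟦X⟧) (hp : Phi R h0 hR (HahnSeries.ofPowerSeries ℤ ℂ p) =
      HahnSeries.ofPowerSeries ℤ ℂ p) :
      HahnSeries.ofPowerSeries ℤ ℂ p = HahnSeries.C (constantCoeff p) := by
    rw [Phi_ofPowerSeries] at hp
    have hsub : p - C (constantCoeff p) = 0 := by
      refine hfix _ (by simp) ?_
      rw [subst_sub (HasSubst.of_constantCoeff_zero' h0),
        HahnSeries.ofPowerSeries_injective hp, subst_C]
      rfl
    rw [← coe_C, ← sub_eq_zero.mp hsub]
  obtain ⟨p, rfl | hp⟩ := exists_eq_ofPowerSeries_or_inv_eq f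
  · exact ⟨_, hseries p hf⟩
  · refine ⟨(constantCoeff p)⁻¹, ?_⟩
    rw [map_inv₀, ← hseries p (by rw [← hp, map_inv₀, hf]), ← hp, inv_inv]

lemma eq_one_of_Phi_eq_C_mul (h1 : coeff 1 R = 0) {f : ℂ⸨X⸩} (hf0 : f ≠ 0) {c : ℂ} (hc : c ≠ 0)
    (hf : Phi R h0 hR f = HahnSeries.C c * f) : c = 1 := by
  have hseries (p : ℂ⟦X⟧) (c : ℂ) (hc : c ≠ 0) (hp0 : HahnSeries.ofPowerSeries ℤ ℂ p ≠ 0)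
      (hp : Phi R h0 hR (HahnSeries.ofPowerSeries ℤ ℂ p) =
        HahnSeries.C c * HahnSeries.ofPowerSeries ℤ ℂ p) : c = 1 := by
    rw [Phi_ofPowerSeries, ← coe_C, ← map_mul] at hp
    have hpow := coeff_one_pow_order_eq_of_subst_eq_C_mul h0 ((map_ne_zero_iff _
      HahnSeries.ofPowerSeries_injective).mp hp0) (HahnSeries.ofPowerSeries_injective hp)
    rw [h1] at hpow
    rw [← hpow, zero_pow_eq_one₀]
    by_contra hm
    exact hc (by rw [← hpow, zero_pow hm])
  obtain ⟨p, rfl | hp⟩ := exists_eq_ofPowerSeries_or_inv_eq f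
  · exact hseries p c hc hf0 hf
  · refine inv_eq_one.mp (hseries p c⁻¹ (inv_ne_zero hc) (hp ▸ inv_ne_zero hf0) ?_)
    rw [← hp, map_inv₀, hf, mul_inv, map_inv₀]

end FixedField

/-! ### The field `ℂ((t))(log t)` -/

section RatFuncFixedField

open Polynomial

variable {L : Type*} [Field L] {φ : L →+* L} {c u : L}

include φ u in
lemma polyHom_ne_zero (hc : c ≠ 0) {p : L[X]} (hp : p ≠ 0) : polyHom φ c u p ≠ 0 :=
  (map_ne_zero_iff _ (eval₂_linear_injective φ c u hc)).mpr hp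

lemma natDegree_polyHom (hc : c ≠ 0) (p : L[X]) : (polyHom φ c u p).natDegree = p.natDegree := by
  rw [polyHom_apply, natDegree_comp, natDegree_linear hc, mul_one, natDegree_map]

lemma leadingCoeff_polyHom (hc : c ≠ 0) (p : L[X]) :
    (polyHom φ c u p).leadingCoeff = c ^ p.natDegree * φ p.leadingCoeff := by
  rw [polyHom_apply, leadingCoeff_comp (by rw [natDegree_linear hc]; exact one_ne_zero),
    leadingCoeff_linear hc, leadingCoeff_map, natDegree_map, mul_comm]

lemma polyHom_num_mul_denom (hc : c ≠ 0) {f : RatFunc L} (hf : ratFuncHom φ c u hc f = f) :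
    polyHom φ c u f.num * f.denom = f.num * polyHom φ c u f.denom := by
  refine RatFunc.algebraMap_injective L ?_
  rw [map_mul, map_mul, ← div_eq_div_iff
    (RatFunc.algebraMap_ne_zero (polyHom_ne_zero hc f.denom_ne_zero))
    (RatFunc.algebraMap_ne_zero f.denom_ne_zero), ← ratFuncHom_algebraMap hc,
    ← ratFuncHom_algebraMap hc, ← map_div₀, RatFunc.num_div_denom, hf]

lemma polyHom_denom_eq (hc : c ≠ 0) {f : RatFunc L} (hf : ratFuncHom φ c u hc f = f) :
    polyHom φ c u f.denom = C (c ^ f.denom.natDegree) * f.denom := by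
  have hdvd : f.denom ∣ polyHom φ c u f.denom :=
    f.isCoprime_num_denom.symm.dvd_of_dvd_mul_left
      (Dvd.intro_left _ (polyHom_num_mul_denom hc hf))
  rw [eq_leadingCoeff_mul_of_monic_of_dvd_of_natDegree_le f.monic_denom hdvd
    (natDegree_polyHom hc _).le, leadingCoeff_polyHom hc, f.monic_denom.leadingCoeff, map_one,
    mul_one]

lemma polyHom_num_eq (hc : c ≠ 0) {f : RatFunc L} (hf : ratFuncHom φ c u hc f = f) :
    polyHom φ c u f.num = C (c ^ f.denom.natDegree) * f.num := by
  have hcross := polyHom_num_mul_denom hc hf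
  rw [polyHom_denom_eq hc hf] at hcross
  exact mul_right_cancel₀ f.denom_ne_zero (hcross.trans (by ring))

/-- The numerator and the denominator of a fixed `f` are eigenvectors for `c ^ m`, where `m` is the
degree of the denominator, and `hφ` forces eigenvectors for `c ^ m` to have degree `m`. Subtracting
from the numerator a constant multiple of the denominator lowers the degree, so it gives `0`. -/
theorem exists_eq_C_of_ratFuncHom_eq_self (hc : c ≠ 0)
    (hφ : ∀ (l : L) (n m : ℕ), l ≠ 0 → c ^ n * φ l = c ^ m * l → n = m) {f : RatFunc L}
    (hf : ratFuncHom φ c u hc f = f) : ∃ a, φ a = a ∧ f = RatFunc.C a := by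
  rcases eq_or_ne f 0 with rfl | hf0
  · exact ⟨0, map_zero φ, (map_zero _).symm⟩
  set m := f.denom.natDegree with hm
  have hdegree {p : L[X]} (hp0 : p ≠ 0) (hp : polyHom φ c u p = C (c ^ m) * p) :
      p.natDegree = m ∧ φ p.leadingCoeff = p.leadingCoeff := by
    have hlead := leadingCoeff_polyHom (φ := φ) (u := u) hc p
    rw [hp, leadingCoeff_mul, leadingCoeff_C] at hlead
    have hnat := hφ _ _ _ (leadingCoeff_ne_zero.mpr hp0) hlead.symm
    rw [hnat] at hlead
    exact ⟨hnat, (mul_left_cancel₀ (pow_ne_zero m hc) hlead).symm⟩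
  obtain ⟨hnum, ha⟩ := hdegree (RatFunc.num_ne_zero hf0) (polyHom_num_eq hc hf)
  set a := f.num.leadingCoeff
  have hdiff : f.num - C a * f.denom = 0 := by
    by_contra hne
    have hcoeff : (f.num - C a * f.denom).coeff m = 0 := by
      rw [coeff_sub, coeff_C_mul, hm, f.monic_denom.coeff_natDegree, mul_one, ← hm, ← hnum,
        coeff_natDegree, sub_self]
    have hdeg := (hdegree hne (by
      rw [map_sub, map_mul, polyHom_num_eq hc hf, polyHom_denom_eq hc hf, polyHom_C, ha]
      ring)).1
    rw [← hdeg, coeff_natDegree, leadingCoeff_eq_zero] at hcoeff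
    exact hne hcoeff
  refine ⟨a, ha, ?_⟩
  conv_lhs => rw [← f.num_div_denom, sub_eq_zero.mp hdiff, map_mul, RatFunc.algebraMap_C]
  exact mul_div_cancel_right₀ _ (RatFunc.algebraMap_ne_zero f.denom_ne_zero)

end RatFuncFixedField

section LogField

open HahnSeries

/-- `ddtLog` bundled as a derivation. -/
noncomputable def ddtLogDerivation : FieldDerivation LogField :=
  ratFuncDerivation ddtDerivation (single (-1) 1)

lemma ddtLog_toLogField (f : ℂ⸨X⸩) : ddtLog (toLogField f) = toLogField (ddt f) :=
  ratFuncDerivation_C ddtDerivation _ f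

lemma derivative_logOf_mul_self {g : ℂ⟦X⟧} (hg : PowerSeries.constantCoeff g = 1) :
    PowerSeries.derivative ℂ (PowerSeries.logOf g) * g = PowerSeries.derivative ℂ g := by
  have hs : PowerSeries.HasSubst (g - 1) := .of_constantCoeff_zero' (by simp [hg])
  have hlog : (1 + PowerSeries.X) * PowerSeries.derivative ℂ (PowerSeries.log ℂ) = 1 := by
    ext n
    rw [PowerSeries.deriv_log, add_mul, one_mul, map_add]
    cases n with
    | zero => simp
    | succ n => simp [PowerSeries.coeff_succ_X_mul, PowerSeries.coeff_one, pow_succ]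
  have hsubst := congrArg (PowerSeries.substAlgHom hs) hlog
  rw [map_mul, map_add, map_one, PowerSeries.substAlgHom_X, add_sub_cancel,
    PowerSeries.coe_substAlgHom] at hsubst
  rw [PowerSeries.logOf_eq, PowerSeries.derivative_subst hs, map_sub, Derivation.map_one_eq_zero,
    sub_zero]
  linear_combination PowerSeries.derivative ℂ g * hsubst

variable {R : ℂ⟦X⟧} (h0 : PowerSeries.constantCoeff R = 0) (hR : R ≠ 0) (ℓ : ℂ)

lemma PhiLog_toLogField (f : ℂ⸨X⸩) :
    PhiLog R h0 hR ℓ (toLogField f) = toLogField (Phi R h0 hR f) :=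
  ratFuncHom_C _ f

include hR in
lemma derivative_logUnitPart_mul_divXPowOrder :
    PowerSeries.derivative ℂ (logUnitPart R ℓ) * PowerSeries.divXPowOrder R =
      PowerSeries.derivative ℂ (PowerSeries.divXPowOrder R) := by
  have hlead : leadCoeff R ≠ 0 := PowerSeries.coeff_order hR
  have hlead' : PowerSeries.C (leadCoeff R)⁻¹ ≠ 0 :=
    (map_ne_zero_iff _ PowerSeries.C_injective).mpr (inv_ne_zero hlead)
  have hlog := derivative_logOf_mul_self
    (g := PowerSeries.C (leadCoeff R)⁻¹ * PowerSeries.divXPowOrder R) (by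
      rw [map_mul, PowerSeries.constantCoeff_C, PowerSeries.constantCoeff_divXPowOrder]
      exact inv_mul_cancel₀ hlead)
  rw [Derivation.leibniz _ (PowerSeries.C _), PowerSeries.derivative_C, smul_zero, add_zero,
    smul_eq_mul, mul_left_comm] at hlog
  rw [logUnitPart, map_add, PowerSeries.derivative_C, zero_add]
  exact mul_left_cancel₀ hlead' hlog

include hR in
lemma X_mul_derivative_eq_mul_add :
    PowerSeries.X * PowerSeries.derivative ℂ R =
      R * ((ord R : ℂ⟦X⟧) + PowerSeries.X * PowerSeries.derivative ℂ (logUnitPart R ℓ)) := by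
  have hX : PowerSeries.X * PowerSeries.derivative ℂ (PowerSeries.X ^ ord R) =
      (ord R : ℂ⟦X⟧) * PowerSeries.X ^ ord R := by
    rw [Derivation.leibniz_pow, PowerSeries.derivative_X]
    rcases ord R with _ | d
    · simp
    · simp only [Nat.add_sub_cancel, nsmul_eq_mul, smul_eq_mul, pow_succ]
      ring
  have hRv : PowerSeries.X ^ ord R * PowerSeries.divXPowOrder R = R :=
    PowerSeries.X_pow_order_mul_divXPowOrder
  have hv := derivative_logUnitPart_mul_divXPowOrder hR ℓ
  conv_lhs => rw [← hRv, Derivation.leibniz, ← hv]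
  simp only [smul_eq_mul]
  linear_combination PowerSeries.divXPowOrder R * hX +
    (ord R + PowerSeries.X * PowerSeries.derivative ℂ (logUnitPart R ℓ)) * hRv

lemma inv_ofPowerSeries_X : (ofPowerSeries ℤ ℂ PowerSeries.X)⁻¹ = single (-1) 1 := by
  rw [PowerSeries.coe_X, inv_single, inv_one]

lemma ddtLog_PhiLog (f : LogField) : ddtLog (PhiLog R h0 hR ℓ f) =
    toLogField (ofPowerSeries ℤ ℂ (PowerSeries.derivative ℂ R)) * PhiLog R h0 hR ℓ (ddtLog f) := by
  refine ratFuncDerivation_chain_rule (D := ddtDerivation) (w := single (-1) 1)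
    (δ := ddtLogDerivation) (fun a => ?_) ?_ f
  · change ddtLog (PhiLog R h0 hR ℓ (toLogField a)) = _ * PhiLog R h0 hR ℓ (toLogField (ddt a))
    rw [PhiLog_toLogField, PhiLog_toLogField, ddtLog_toLogField, ddt_Phi, map_mul]
  · have hX0 : ofPowerSeries ℤ ℂ PowerSeries.X ≠ 0 :=
      (map_ne_zero_iff _ ofPowerSeries_injective).mpr PowerSeries.X_ne_zero
    have hR0 : ofPowerSeries ℤ ℂ R ≠ 0 := (map_ne_zero_iff _ ofPowerSeries_injective).mpr hR
    have hlog := congrArg (ofPowerSeries ℤ ℂ) (X_mul_derivative_eq_mul_add hR ℓ)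
    simp only [map_add, map_mul, map_natCast] at hlog
    have hlaurent : (ord R : ℂ⸨X⸩) * single (-1) 1 + ddt (ofPowerSeries ℤ ℂ (logUnitPart R ℓ)) =
        ofPowerSeries ℤ ℂ (PowerSeries.derivative ℂ R) * Phi R h0 hR (single (-1) 1) := by
      rw [ddt_ofPowerSeries, ← inv_ofPowerSeries_X, map_inv₀, Phi_ofPowerSeries,
        PowerSeries.subst_X (.of_constantCoeff_zero' h0)]
      field_simp
      linear_combination -hlog
    change _ = toLogField _ * PhiLog R h0 hR ℓ (toLogField _)
    rw [PhiLog_toLogField, ← map_mul, ← hlaurent, PhiLog, ratFuncHom_X, map_add,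
      derivation_mul, ddtLogDerivation, ratFuncDerivation_X, ratFuncDerivation_C,
      ratFuncDerivation_C, coe_ddtDerivation, ddt_C, map_natCast]
    simp [toLogField, toTransExt]

/-- Since `R` vanishes at `0` to order `d ≥ 2`, the powers of `d` are distinct. -/
lemma exists_eq_C_of_PhiLog_eq_self (h1 : PowerSeries.coeff 1 R = 0) {f : LogField}
    (hf : PhiLog R h0 hR ℓ f = f) : ∃ a, f = toLogField (C a) := by
  have hord1 : ord R ≠ 1 := fun h => PowerSeries.coeff_order hR (by rwa [← ord, h])
  have hord : 2 ≤ ord R := by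
    have := toNat_order_ne_zero hR h0
    unfold ord at *
    omega
  have hord0 : (ord R : ℂ) ≠ 0 := Nat.cast_ne_zero.mpr (by omega)
  obtain ⟨g, hg, rfl⟩ := exists_eq_C_of_ratFuncHom_eq_self _ (fun l n m hl h => by
    have hratio : (ord R : ℂ) ^ m / (ord R : ℂ) ^ n = 1 :=
      eq_one_of_Phi_eq_C_mul h0 hR h1 hl
        (div_ne_zero (pow_ne_zero m hord0) (pow_ne_zero n hord0)) (by
          rw [map_div₀, div_mul_eq_mul_div, eq_div_iff ((map_ne_zero _).mpr (pow_ne_zero n hord0)),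
            map_pow, map_pow, ← h, mul_comm])
    rw [div_eq_one_iff_eq (pow_ne_zero n hord0)] at hratio
    exact (Nat.pow_right_injective hord (by exact_mod_cast hratio)).symm) hf
  obtain ⟨a, rfl⟩ := exists_eq_C_of_Phi_eq_self h0 hR
    (fun p => eq_zero_of_subst_eq_self_of_coeff_one_eq_zero h0 h1) hg
  exact ⟨a, rfl⟩

end LogField

/-! ### Residues and logarithmic derivatives in `ℂ(t)` -/

section Residue

open HahnSeries

/-- The rational functions `∑ r_α / (t - α)` with simple poles, as a function of their residues. -/
noncomputable def polarSum : (ℂ →₀ ℂ) →ₗ[ℂ] RatFunc ℂ :=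
  Finsupp.linearCombination ℂ fun α => (RatFunc.X - RatFunc.C α)⁻¹

lemma polarSum_single (α c : ℂ) :
    polarSum (Finsupp.single α c) = c • (RatFunc.X - RatFunc.C α)⁻¹ :=
  Finsupp.linearCombination_single ℂ c α

/-- The expansion of rational functions at the point `α`, in the local parameter `t - α`. -/
noncomputable def expansionAt (α : ℂ) : RatFunc ℂ →+* ℂ⸨X⸩ :=
  expansion.comp (ratFuncHom (RingHom.id ℂ) 1 α one_ne_zero)

@[simp] lemma expansionAt_C (α c : ℂ) : expansionAt α (RatFunc.C c) = C c := by
  simp [expansionAt, -C_apply]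

@[simp] lemma expansionAt_X (α : ℂ) : expansionAt α RatFunc.X =
    ofPowerSeries ℤ ℂ (PowerSeries.X + PowerSeries.C α) := by
  simp [expansionAt, -C_apply]

lemma ddt_expansionAt (α : ℂ) (f : RatFunc ℂ) :
    ddt (expansionAt α f) = expansionAt α (ratDeriv f) := by
  have h := ratFuncDerivation_chain_rule (D := 0) (w := 1) (δ := ddtDerivation)
    (Φ := expansionAt α) (ρ := 1) (fun a => by simp [ddt_C, -C_apply]) (by
      rw [expansionAt_X, coe_ddtDerivation, ddt_ofPowerSeries]
      simp) f
  rwa [one_mul] at h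

/-- The residue of a rational function at the point `α`. -/
noncomputable def residue (α : ℂ) : RatFunc ℂ →ₗ[ℂ] ℂ where
  toFun f := (expansionAt α f).coeff (-1)
  map_add' f g := by rw [map_add, coeff_add]
  map_smul' c f := by
    rw [RatFunc.smul_eq_C_mul, map_mul, expansionAt_C, C_mul_eq_smul, coeff_smul,
      RingHom.id_apply]

lemma residue_apply (α : ℂ) (f : RatFunc ℂ) : residue α f = (expansionAt α f).coeff (-1) := rfl

lemma residue_ratDeriv (α : ℂ) (f : RatFunc ℂ) : residue α (ratDeriv f) = 0 := by
  rw [residue_apply, ← ddt_expansionAt, ddt_coeff]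
  simp

lemma residue_inv_X_sub_C_self (α : ℂ) : residue α (RatFunc.X - RatFunc.C α)⁻¹ = 1 := by
  rw [residue_apply, map_inv₀, map_sub, expansionAt_X, expansionAt_C, map_add, PowerSeries.coe_C,
    add_sub_cancel_right, inv_ofPowerSeries_X, coeff_single_same]

lemma residue_inv_X_sub_C_of_ne {α β : ℂ} (h : β ≠ α) :
    residue α (RatFunc.X - RatFunc.C β)⁻¹ = 0 := by
  set p : ℂ⟦X⟧ := PowerSeries.X + PowerSeries.C α - PowerSeries.C β
  have hp : PowerSeries.constantCoeff p ≠ 0 := by simpa [p, sub_eq_zero] using h.symm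
  have hinv : expansionAt α (RatFunc.X - RatFunc.C β)⁻¹ = ofPowerSeries ℤ ℂ p⁻¹ := by
    rw [map_inv₀, map_sub, expansionAt_X, expansionAt_C, ← PowerSeries.coe_C, ← map_sub]
    exact inv_eq_of_mul_eq_one_right (by rw [← map_mul, PowerSeries.mul_inv_cancel p hp, map_one])
  rw [residue_apply, hinv, PowerSeries.coeff_coe, if_pos (by norm_num)]

lemma residue_polarSum (α : ℂ) (r : ℂ →₀ ℂ) : residue α (polarSum r) = r α := by
  induction r using Finsupp.induction_linear with
  | zero => simp
  | add r s hr hs => rw [map_add, map_add, hr, hs, Finsupp.add_apply]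
  | single β c =>
    rw [polarSum_single, map_smul, smul_eq_mul]
    rcases eq_or_ne β α with rfl | h
    · rw [residue_inv_X_sub_C_self, mul_one, Finsupp.single_eq_same]
    · rw [residue_inv_X_sub_C_of_ne h, mul_zero, Finsupp.single_eq_of_ne' h]

lemma eq_of_ratDeriv_add_polarSum_eq {f g : RatFunc ℂ} {r s : ℂ →₀ ℂ}
    (h : ratDeriv f + polarSum r = ratDeriv g + polarSum s) : r = s := by
  ext α
  have hres := congrArg (residue α) h
  rwa [map_add, map_add, residue_ratDeriv, residue_ratDeriv, zero_add, zero_add, residue_polarSum,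
    residue_polarSum] at hres

end Residue

section PartialFractions

open Polynomial

lemma derivation_zpow {F : Type*} [Field F] (δ : FieldDerivation F) (x : F) (n : ℤ) :
    δ (x ^ n) = n * x ^ (n - 1) * δ x := by
  rw [Derivation.leibniz_zpow, smul_eq_mul, zsmul_eq_mul, mul_assoc]

lemma X_sub_C_ne_zero (α : ℂ) : (RatFunc.X - RatFunc.C α : RatFunc ℂ) ≠ 0 := by
  rw [← RatFunc.algebraMap_X, ← RatFunc.algebraMap_C, ← map_sub]
  exact RatFunc.algebraMap_ne_zero (Polynomial.X_sub_C_ne_zero α)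

lemma ratDeriv_X_sub_C (α : ℂ) : ratDeriv (RatFunc.X - RatFunc.C α) = 1 := by
  rw [map_sub, ratDeriv_X, ratDeriv_C, sub_zero]

lemma ratDeriv_smul (c : ℂ) (f : RatFunc ℂ) : ratDeriv (c • f) = c • ratDeriv f := by
  rw [RatFunc.smul_eq_C_mul, RatFunc.smul_eq_C_mul, derivation_mul, ratDeriv_C, mul_zero, add_zero]

/-- The space of the functions `g' + ∑ r_α / (t - α)`. By the partial fraction decomposition it
contains all rational functions. -/
noncomputable def derivAddPolar : Submodule ℂ (RatFunc ℂ) :=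
  LinearMap.range ({ ratDeriv.toAddMonoidHom with map_smul' := ratDeriv_smul } :
    RatFunc ℂ →ₗ[ℂ] RatFunc ℂ) ⊔ LinearMap.range polarSum

lemma ratDeriv_mem_derivAddPolar (g : RatFunc ℂ) : ratDeriv g ∈ derivAddPolar :=
  Submodule.mem_sup_left ⟨g, rfl⟩

lemma zpow_X_sub_C_mem_derivAddPolar (α : ℂ) (n : ℤ) :
    (RatFunc.X - RatFunc.C α) ^ n ∈ derivAddPolar := by
  rcases eq_or_ne n (-1) with rfl | hn
  · refine Submodule.mem_sup_right ⟨Finsupp.single α 1, ?_⟩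
    rw [polarSum_single, one_smul, zpow_neg_one]
  · have hn' : ((n + 1 : ℤ) : ℂ) ≠ 0 := Int.cast_ne_zero.mpr fun h => hn (by omega)
    have hderiv : ratDeriv ((RatFunc.X - RatFunc.C α) ^ (n + 1)) =
        ((n + 1 : ℤ) : ℂ) • (RatFunc.X - RatFunc.C α) ^ n := by
      rw [derivation_zpow, ratDeriv_X_sub_C, add_sub_cancel_right, mul_one,
        RatFunc.smul_eq_C_mul, map_intCast]
    rw [← inv_smul_smul₀ hn' ((RatFunc.X - RatFunc.C α) ^ n), ← hderiv]
    exact derivAddPolar.smul_mem _ (ratDeriv_mem_derivAddPolar _)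

lemma algebraMap_mem_derivAddPolar (p : ℂ[X]) :
    algebraMap ℂ[X] (RatFunc ℂ) p ∈ derivAddPolar := by
  induction p using Polynomial.induction_on' with
  | add p q hp hq => rw [map_add]; exact derivAddPolar.add_mem hp hq
  | monomial n c =>
    rw [← C_mul_X_pow_eq_monomial, map_mul, map_pow, RatFunc.algebraMap_C, RatFunc.algebraMap_X,
      ← RatFunc.smul_eq_C_mul, ← zpow_natCast, ← sub_zero RatFunc.X, ← map_zero RatFunc.C]
    exact derivAddPolar.smul_mem c (zpow_X_sub_C_mem_derivAddPolar 0 n)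

lemma eq_C_mul_prod_X_sub_C_pow (p : ℂ[X]) :
    p = C p.leadingCoeff * ∏ α ∈ p.roots.toFinset, (X - C α) ^ p.rootMultiplicity α := by
  conv_lhs => rw [(IsAlgClosed.splits p).eq_prod_roots, Finset.prod_multiset_map_count]
  simp only [count_roots]

lemma mem_derivAddPolar (f : RatFunc ℂ) : f ∈ derivAddPolar := by
  obtain ⟨q, r, hr, hf⟩ := mul_prod_pow_inverse_eq_quo_add_sum_rem_mul_pow_inverse (K := RatFunc ℂ)
    (s := f.denom.roots.toFinset) f.num (g := fun α => X - C α) (fun α _ => monic_X_sub_C α)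
    (fun α _ β _ h => isCoprime_X_sub_C_of_isUnit_sub (sub_ne_zero.mpr h).isUnit)
    (fun α => f.denom.rootMultiplicity α) (gi := fun α => (RatFunc.X - RatFunc.C α)⁻¹)
    (fun α _ => by
      rw [map_sub, RatFunc.algebraMap_X, RatFunc.algebraMap_C,
        inv_mul_cancel₀ (X_sub_C_ne_zero α)])
  have hdenom : f = algebraMap ℂ[X] (RatFunc ℂ) f.num * ∏ α ∈ f.denom.roots.toFinset,
      (RatFunc.X - RatFunc.C α)⁻¹ ^ f.denom.rootMultiplicity α := by
    conv_lhs => rw [← RatFunc.num_div_denom f, eq_C_mul_prod_X_sub_C_pow f.denom,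
      (RatFunc.monic_denom f).leadingCoeff, C_1, one_mul, div_eq_mul_inv, map_prod,
      ← Finset.prod_inv_distrib]
    simp only [map_pow, map_sub, RatFunc.algebraMap_X, RatFunc.algebraMap_C, inv_pow]
  rw [hdenom, hf]
  refine derivAddPolar.add_mem (algebraMap_mem_derivAddPolar q)
    (derivAddPolar.sum_mem fun α hα => derivAddPolar.sum_mem fun j _ => ?_)
  have hdeg : (r α j).degree ≤ 0 :=
    Nat.WithBot.lt_one_iff_le_zero.mp ((hr α hα j).trans_eq (degree_X_sub_C α))
  rw [eq_C_of_degree_le_zero hdeg, RatFunc.algebraMap_C, ← RatFunc.smul_eq_C_mul, inv_pow,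
    ← zpow_natCast, ← zpow_neg]
  exact derivAddPolar.smul_mem _ (zpow_X_sub_C_mem_derivAddPolar α _)

lemma exists_eq_ratDeriv_add_polarSum (f : RatFunc ℂ) :
    ∃ g r, f = ratDeriv g + polarSum r := by
  obtain ⟨_, ⟨g, rfl⟩, _, ⟨r, rfl⟩, h⟩ := Submodule.mem_sup.mp (mem_derivAddPolar f)
  exact ⟨g, r, h.symm⟩

end PartialFractions

section LogDeriv

open Polynomial

noncomputable instance : Differential (RatFunc ℂ) := ⟨ratDeriv⟩

noncomputable instance : Differential ℂ⸨X⸩ := ⟨ddtDerivation⟩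

instance : DifferentialAlgebra (RatFunc ℂ) ℂ⸨X⸩ := ⟨ddt_expansion⟩

lemma logDeriv_zpow {F : Type*} [Field F] [Differential F] (n : ℤ) (x : F) :
    Differential.logDeriv (x ^ n) = n * Differential.logDeriv x := by
  rcases eq_or_ne x 0 with rfl | hx
  · rw [zero_zpow_eq]
    split_ifs <;> simp
  · rw [Differential.logDeriv, derivation_zpow, zpow_sub_one₀ hx, Differential.logDeriv]
    field_simp

/-- A function with finite support and integer values, with its values regarded in the ring `k`. -/
noncomputable def intCoeffs (ι k : Type*) [Ring k] : (ι →₀ ℤ) →+ (ι →₀ k) :=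
  Finsupp.mapRange.addMonoidHom (Int.castAddHom k)

lemma intCoeffs_single {ι k : Type*} [Ring k] (i : ι) (n : ℤ) :
    intCoeffs ι k (Finsupp.single i n) = Finsupp.single i (n : k) := by
  rw [intCoeffs, Finsupp.mapRange.addMonoidHom_apply, Finsupp.mapRange_single, Int.coe_castAddHom]

lemma logDeriv_C (c : ℂ) : Differential.logDeriv (RatFunc.C c) = 0 :=
  (Differential.logDeriv_eq_zero _).mpr (ratDeriv_C c)

lemma logDeriv_X_sub_C_zpow (α : ℂ) (n : ℤ) :
    Differential.logDeriv ((RatFunc.X - RatFunc.C α) ^ n) =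
      polarSum (intCoeffs ℂ ℂ (Finsupp.single α n)) := by
  have hlog : Differential.logDeriv (RatFunc.X - RatFunc.C α) = (RatFunc.X - RatFunc.C α)⁻¹ := by
    change ratDeriv (RatFunc.X - RatFunc.C α) / _ = _
    rw [ratDeriv_X_sub_C, one_div]
  rw [logDeriv_zpow, hlog, intCoeffs_single, polarSum_single, RatFunc.smul_eq_C_mul, map_intCast]

lemma exists_logDeriv_algebraMap_eq_polarSum {p : ℂ[X]} (hp : p ≠ 0) : ∃ m : ℂ →₀ ℤ,
    Differential.logDeriv (algebraMap ℂ[X] (RatFunc ℂ) p) = polarSum (intCoeffs ℂ ℂ m) := by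
  refine ⟨∑ α ∈ p.roots.toFinset, Finsupp.single α (p.rootMultiplicity α : ℤ), ?_⟩
  have hprod : algebraMap ℂ[X] (RatFunc ℂ) p = RatFunc.C p.leadingCoeff *
      ∏ α ∈ p.roots.toFinset, (RatFunc.X - RatFunc.C α) ^ (p.rootMultiplicity α : ℤ) := by
    conv_lhs => rw [eq_C_mul_prod_X_sub_C_pow p]
    simp only [map_mul, map_prod, map_pow, map_sub, RatFunc.algebraMap_X, RatFunc.algebraMap_C,
      zpow_natCast]
  have hne : ∀ α ∈ p.roots.toFinset,
      (RatFunc.X - RatFunc.C α) ^ (p.rootMultiplicity α : ℤ) ≠ 0 :=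
    fun α _ => zpow_ne_zero _ (X_sub_C_ne_zero α)
  rw [hprod, Differential.logDeriv_mul _ _
    ((_root_.map_ne_zero _).mpr (leadingCoeff_ne_zero.mpr hp)) (Finset.prod_ne_zero_iff.mpr hne),
    logDeriv_C, zero_add, Differential.logDeriv_prod _ _ _ hne, map_sum, map_sum]
  exact Finset.sum_congr rfl fun α _ => logDeriv_X_sub_C_zpow α _

lemma exists_logDeriv_eq_polarSum {v : RatFunc ℂ} (hv : v ≠ 0) :
    ∃ m : ℂ →₀ ℤ, Differential.logDeriv v = polarSum (intCoeffs ℂ ℂ m) := by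
  obtain ⟨m, hm⟩ := exists_logDeriv_algebraMap_eq_polarSum (RatFunc.num_ne_zero hv)
  obtain ⟨n, hn⟩ := exists_logDeriv_algebraMap_eq_polarSum v.denom_ne_zero
  refine ⟨m - n, ?_⟩
  rw [map_sub, map_sub, ← hm, ← hn, ← Differential.logDeriv_div _ _
    (RatFunc.algebraMap_ne_zero (RatFunc.num_ne_zero hv))
    (RatFunc.algebraMap_ne_zero v.denom_ne_zero), RatFunc.num_div_denom]

lemma exists_ne_zero_logDeriv_eq_polarSum (m : ℂ →₀ ℤ) :
    ∃ v : RatFunc ℂ, v ≠ 0 ∧ Differential.logDeriv v = polarSum (intCoeffs ℂ ℂ m) := by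
  induction m using Finsupp.induction_linear with
  | zero => exact ⟨1, one_ne_zero, by simp⟩
  | add m n hm hn =>
    obtain ⟨v, hv, hvm⟩ := hm
    obtain ⟨w, hw, hwn⟩ := hn
    exact ⟨v * w, mul_ne_zero hv hw, by
      rw [Differential.logDeriv_mul v w hv hw, hvm, hwn, map_add, map_add]⟩
  | single α n =>
    exact ⟨(RatFunc.X - RatFunc.C α) ^ n, zpow_ne_zero n (X_sub_C_ne_zero α),
      logDeriv_X_sub_C_zpow α n⟩

end LogDeriv

section ResidueTransfer

variable {ι k : Type*} [Field k]

lemma exists_ratCast_eq [CharZero k] {x : k} (hx : ∀ l : k →ₗ[ℚ] ℚ, l 1 = 0 → l x = 0) :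
    ∃ q : ℚ, (q : k) = x := by
  by_contra! h
  have hmem : x ∉ Submodule.span ℚ {(1 : k)} := by
    rw [Submodule.mem_span_singleton]
    rintro ⟨q, hq⟩
    exact h q (by rw [← hq, Rat.smul_def, mul_one])
  obtain ⟨l, hl, hle⟩ := Submodule.exists_le_ker_of_notMem hmem
  exact hl (hx l (hle (Submodule.mem_span_singleton_self 1)))

/-- The operator on residue data that sends the point `i` to the divisor `m i`. If `m α` is the
divisor of zeros and poles of `R - α`, it describes the action of `f ↦ R' (f ∘ R)` on residues. -/
noncomputable def residueTransfer (m : ι → ι →₀ ℤ) : (ι →₀ k) →ₗ[k] (ι →₀ k) :=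
  Finsupp.linearCombination k fun i => intCoeffs ι k (m i)

lemma residueTransfer_mapRange (m : ι → ι →₀ ℤ) (l : k →+ k) (s : ι →₀ k) :
    residueTransfer m (Finsupp.mapRange.addMonoidHom l s) =
      Finsupp.mapRange.addMonoidHom l (residueTransfer m s) := by
  induction s using Finsupp.induction_linear with
  | zero => simp only [map_zero]
  | add s t hs ht => simp only [map_add, hs, ht]
  | single i c =>
    rw [Finsupp.mapRange.addMonoidHom_apply, Finsupp.mapRange_single, residueTransfer,
      Finsupp.linearCombination_single, Finsupp.linearCombination_single]
    ext j
    simp [intCoeffs, mul_comm _ (Int.cast _ : k), ← zsmul_eq_mul]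

lemma exists_ratCast_eq_of_residueTransfer_eq_add [CharZero k] {m : ι → ι →₀ ℤ}
    (hfix : ∀ s : ι →₀ k, residueTransfer m s = s → s = 0) {r : ι →₀ k} {n : ι →₀ ℤ}
    (hr : residueTransfer m r = r + intCoeffs ι k n) (i : ι) : ∃ q : ℚ, (q : k) = r i := by
  refine exists_ratCast_eq fun l hl => ?_
  let l' : k →+ k := (Rat.castHom k).toAddMonoidHom.comp l.toAddMonoidHom
  have hint : Finsupp.mapRange.addMonoidHom l' (intCoeffs ι k n) = 0 := by
    ext j
    have hj : l' (n j : k) = 0 := by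
      rw [← zsmul_one, map_zsmul]
      simp [l', hl]
    simpa [intCoeffs] using hj
  have hzero := hfix (Finsupp.mapRange.addMonoidHom l' r) (by
    rw [residueTransfer_mapRange, hr, map_add, hint, add_zero])
  simpa [l'] using DFunLike.congr_fun hzero i

lemma exists_nsmul_eq_intCoeffs [CharZero k] {r : ι →₀ k} (hr : ∀ i, ∃ q : ℚ, (q : k) = r i) :
    ∃ N : ℕ, 0 < N ∧ ∃ n : ι →₀ ℤ, N • r = intCoeffs ι k n := by
  choose q hq using hr
  refine ⟨∏ i ∈ r.support, (q i).den, Finset.prod_pos fun i _ => (q i).den_pos, ?_⟩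
  have hint : ∀ i, ((∏ i ∈ r.support, (q i).den) • r) i ∈ Set.range (Int.cast : ℤ → k) := by
    intro i
    by_cases hi : i ∈ r.support
    · obtain ⟨c, hc⟩ := Finset.dvd_prod_of_mem (fun i => (q i).den) hi
      refine ⟨c * (q i).num, ?_⟩
      rw [Finsupp.smul_apply, hc, ← hq, nsmul_eq_mul]
      have hnum : (q i : k) * (q i).den = (q i).num := mod_cast Rat.mul_den_eq_num (q i)
      push_cast
      linear_combination -(c : k) * hnum
    · exact ⟨0, by simp [Finsupp.notMem_support_iff.mp hi]⟩
  obtain ⟨n, hn⟩ := (Finsupp.range_mapRange Int.cast Int.cast_zero).ge hint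
  exact ⟨n, hn.symm⟩

end ResidueTransfer

section RationalEquation

variable (τ : RatFunc ℂ →ₐ[ℂ] RatFunc ℂ)

lemma algHom_C (c : ℂ) : τ (RatFunc.C c) = RatFunc.C c := τ.commutes c

lemma ratDeriv_algHom (f : RatFunc ℂ) :
    ratDeriv (τ f) = ratDeriv (τ RatFunc.X) * τ (ratDeriv f) := by
  refine ratFuncDerivation_chain_rule (D := 0) (w := 1) (Φ := (τ : RatFunc ℂ →+* RatFunc ℂ))
    (fun a => ?_) ?_ f
  · simp [algHom_C]
  · simp

lemma ratDeriv_X_mul_algHom_polarSum {m : ℂ → ℂ →₀ ℤ}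
    (hm : ∀ α, Differential.logDeriv (τ RatFunc.X - RatFunc.C α) =
      polarSum (intCoeffs ℂ ℂ (m α))) (r : ℂ →₀ ℂ) :
    ratDeriv (τ RatFunc.X) * τ (polarSum r) = polarSum (residueTransfer m r) := by
  induction r using Finsupp.induction_linear with
  | zero => simp only [map_zero, mul_zero]
  | add r s hr hs => rw [map_add, map_add, map_add, map_add, mul_add, hr, hs]
  | single α c =>
    have hderiv : ratDeriv (τ RatFunc.X - RatFunc.C α) = ratDeriv (τ RatFunc.X) := by
      rw [map_sub, ratDeriv_C, sub_zero]
    have hlog : ratDeriv (τ RatFunc.X) * (τ RatFunc.X - RatFunc.C α)⁻¹ =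
        polarSum (intCoeffs ℂ ℂ (m α)) := by
      rw [← hm, ← hderiv, ← div_eq_mul_inv]
      rfl
    rw [polarSum_single, RatFunc.smul_eq_C_mul, map_mul, map_inv₀, map_sub, algHom_C, algHom_C,
      mul_left_comm, hlog, residueTransfer, Finsupp.linearCombination_single, map_smul,
      RatFunc.smul_eq_C_mul]

theorem exists_nat_mul_eq_logDeriv (hzero : ∀ w, ratDeriv (τ RatFunc.X) * τ w = w → w = 0)
    {a h : RatFunc ℂ} (ha : a ≠ 0)
    (hh : ratDeriv (τ RatFunc.X) * τ h = h + Differential.logDeriv a) :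
    ∃ N : ℕ, 0 < N ∧ ∃ v : RatFunc ℂ, v ≠ 0 ∧ N * h = Differential.logDeriv v := by
  have hne (α : ℂ) : τ RatFunc.X - RatFunc.C α ≠ 0 := by
    rw [← algHom_C τ, ← map_sub]
    exact (map_ne_zero τ).mpr (X_sub_C_ne_zero α)
  choose m hm using fun α => exists_logDeriv_eq_polarSum (hne α)
  have hT := ratDeriv_X_mul_algHom_polarSum τ hm
  obtain ⟨n, hn⟩ := exists_logDeriv_eq_polarSum ha
  obtain ⟨g, r, rfl⟩ := exists_eq_ratDeriv_add_polarSum h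
  have hsplit : ratDeriv (τ g) + polarSum (residueTransfer m r) =
      ratDeriv g + polarSum (r + intCoeffs ℂ ℂ n) := by
    rw [ratDeriv_algHom, ← hT, ← mul_add, ← map_add, hh, hn, map_add, add_assoc]
  have hr := eq_of_ratDeriv_add_polarSum_eq hsplit
  have hg : ratDeriv g = 0 := by
    refine hzero _ ?_
    rw [hr] at hsplit
    rw [← ratDeriv_algHom, add_right_cancel hsplit]
  have hfix (s : ℂ →₀ ℂ) (hs : residueTransfer m s = s) : s = 0 := by
    refine eq_of_ratDeriv_add_polarSum_eq (f := 0) (g := 0) ?_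
    rw [map_zero polarSum, hzero (polarSum s) (by rw [hT, hs])]
  obtain ⟨N, hN, k, hk⟩ :=
    exists_nsmul_eq_intCoeffs (exists_ratCast_eq_of_residueTransfer_eq_add hfix hr)
  obtain ⟨v, hv, hvk⟩ := exists_ne_zero_logDeriv_eq_polarSum k
  exact ⟨N, hN, v, hv, by rw [hvk, ← hk, map_nsmul, hg, zero_add, nsmul_eq_mul]⟩

end RationalEquation

lemma exists_algHom_expansion {R : ℂ⟦X⟧} (h0 : PowerSeries.constantCoeff R = 0) (hR : R ≠ 0)
    (hrat : HahnSeries.ofPowerSeries ℤ ℂ R ∈ expansion.range) :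
    ∃ τ : RatFunc ℂ →ₐ[ℂ] RatFunc ℂ, ∀ f, expansion (τ f) = Phi R h0 hR (expansion f) := by
  choose t ht using fun f => RingHom.mem_range.mp (Phi_expansion_mem_range h0 hR hrat f)
  refine ⟨{
    toFun := t
    map_one' := expansion.injective (by simp only [ht, map_one])
    map_mul' := fun f g => expansion.injective (by simp only [ht, map_mul])
    map_zero' := expansion.injective (by simp only [ht, map_zero])
    map_add' := fun f g => expansion.injective (by simp only [ht, map_add])
    commutes' := fun c => expansion.injective ?_ }, ht⟩
  change expansion (t (RatFunc.C c)) = expansion (RatFunc.C c)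
  rw [ht, expansion_C, Phi_C]

/-! ### Solutions of `Φ_R(z) = a z` -/

lemma derivative_mul_Phi_logDeriv {R : ℂ⟦X⟧} (h0 : PowerSeries.constantCoeff R = 0) (hR : R ≠ 0)
    (z : ℂ⸨X⸩) : HahnSeries.ofPowerSeries ℤ ℂ (PowerSeries.derivative ℂ R) *
      Phi R h0 hR (Differential.logDeriv z) = Differential.logDeriv (Phi R h0 hR z) := by
  change _ * Phi R h0 hR (ddt z / z) = ddt (Phi R h0 hR z) / Phi R h0 hR z
  rw [map_div₀, ddt_Phi, mul_div_assoc]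

lemma coeff_ne_zero_of_Phi_eq_mul {R : ℂ⟦X⟧} (h0 : PowerSeries.constantCoeff R = 0) (hR : R ≠ 0)
    {a : RatFunc ℂ} {z : ℂ⸨X⸩} (hz0 : z ≠ 0) (hz : Phi R h0 hR z = expansion a * z) : a ≠ 0 := by
  rintro rfl
  rw [map_zero, zero_mul] at hz
  exact hz0 ((map_eq_zero _).mp hz)

lemma derivative_mul_Phi_logDeriv_eq_add {R : ℂ⟦X⟧} (h0 : PowerSeries.constantCoeff R = 0)
    (hR : R ≠ 0) {a : RatFunc ℂ} {z : ℂ⸨X⸩} (hz0 : z ≠ 0) (hz : Phi R h0 hR z = expansion a * z) :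
    HahnSeries.ofPowerSeries ℤ ℂ (PowerSeries.derivative ℂ R) *
      Phi R h0 hR (Differential.logDeriv z) =
      Differential.logDeriv z + expansion (Differential.logDeriv a) := by
  have ha := (map_ne_zero expansion).mpr (coeff_ne_zero_of_Phi_eq_mul h0 hR hz0 hz)
  rw [derivative_mul_Phi_logDeriv, hz, Differential.logDeriv_mul _ _ ha hz0, add_comm]
  exact congrArg _ (Differential.logDeriv_algebraMap a)

lemma pow_mem_range_of_mul_logDeriv_eq {z : ℂ⸨X⸩} (hz : z ≠ 0) {v : RatFunc ℂ} (hv : v ≠ 0) {N : ℕ}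
    (h : N * Differential.logDeriv z = expansion (Differential.logDeriv v)) :
    z ^ N ∈ expansion.range := by
  have hv' : expansion v ≠ 0 := (map_ne_zero _).mpr hv
  have hquot : Differential.logDeriv (z ^ N / expansion v) = 0 := by
    rw [Differential.logDeriv_div _ _ (pow_ne_zero N hz) hv', Differential.logDeriv_pow, h]
    exact sub_eq_zero.mpr (Differential.logDeriv_algebraMap v).symm
  have hC := eq_C_of_ddt_eq_zero ((Differential.logDeriv_eq_zero _).mp hquot)
  exact ⟨RatFunc.C _ * v, by rw [map_mul, expansion_C, ← hC, div_mul_cancel₀ _ hv']⟩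

lemma isDiffAlgebraic_map {K E F : Type*} [Field K] [Field E] [Field F] {j : K →+* E} {D : E → E}
    {D' : F → F} (ι : E →+* F) (hι : ∀ x, D' (ι x) = ι (D x)) {f : E}
    (hf : IsDiffAlgebraic j D f) : IsDiffAlgebraic (ι.comp j) D' (ι f) := by
  obtain ⟨n, P, hP, h⟩ := hf
  refine ⟨n, P, hP, ?_⟩
  have hsemiconj : Function.Semiconj ι D D' := fun x => (hι x).symm
  have hiter (i : ℕ) : D'^[i] (ι f) = ι (D^[i] f) := (hsemiconj.iterate_right i f).symm
  simp only [hiter]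
  rw [← Function.comp_def ι, ← MvPolynomial.eval₂_comp_left, h, map_zero]

/-- An extension `F` of `ℂ((t))` with extensions of `d/dt` and of `Φ_R` to `F` that still obey the
chain rule and for which the constants of `Φ` are the complex numbers. It abstracts the properties
that the fields `ℂ((t))` and `ℂ((t))(log t)` share. -/
structure SubstitutionExtension {R : ℂ⟦X⟧} (h0 : PowerSeries.constantCoeff R = 0) (hR : R ≠ 0)
    (F : Type*) [Field F] where
  ι : ℂ⸨X⸩ →+* F
  δ : FieldDerivation F
  Φ : F →+* F
  δ_ι : ∀ f, δ (ι f) = ι (ddt f)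
  Φ_ι : ∀ f, Φ (ι f) = ι (Phi R h0 hR f)
  chain_rule : ∀ x,
    δ (Φ x) = ι (HahnSeries.ofPowerSeries ℤ ℂ (PowerSeries.derivative ℂ R)) * Φ (δ x)
  eq_C_of_Φ_eq_self : ∀ x, Φ x = x → ∃ c, x = ι (HahnSeries.C c)

namespace SubstitutionExtension

variable {R : ℂ⟦X⟧} {h0 : PowerSeries.constantCoeff R = 0} {hR : R ≠ 0}

/-- The field `ℂ((t))` itself. -/
noncomputable def laurent (hiter : ∀ n, 0 < n → iter R n ≠ PowerSeries.X) :
    SubstitutionExtension h0 hR ℂ⸨X⸩ where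
  ι := RingHom.id _
  δ := ddtDerivation
  Φ := Phi R h0 hR
  δ_ι _ := rfl
  Φ_ι _ := rfl
  chain_rule := ddt_Phi h0 hR
  eq_C_of_Φ_eq_self _ :=
    exists_eq_C_of_Phi_eq_self h0 hR fun _ => eq_zero_of_subst_eq_self_of_iter_ne h0 hiter

/-- The field `ℂ((t))(log t)`, for `R'(0) = 0`. -/
noncomputable def logarithmic (ℓ : ℂ) (h1 : PowerSeries.coeff 1 R = 0) :
    SubstitutionExtension h0 hR LogField where
  ι := toLogField
  δ := ddtLogDerivation
  Φ := PhiLog R h0 hR ℓ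
  δ_ι := ddtLog_toLogField
  Φ_ι := PhiLog_toLogField h0 hR ℓ
  chain_rule := ddtLog_PhiLog h0 hR ℓ
  eq_C_of_Φ_eq_self _ := exists_eq_C_of_PhiLog_eq_self h0 hR ℓ h1

variable {F : Type*} [Field F] (S : SubstitutionExtension h0 hR F)

/-- `F` as an extension of `ℂ(t)`. -/
noncomputable abbrev algebra : Algebra (RatFunc ℂ) F := (S.ι.comp expansion).toAlgebra

/-- The chain rule over `ℂ(t)`, for a rational function `R`. -/
noncomputable def chainRulePair (hrat : HahnSeries.ofPowerSeries ℤ ℂ R ∈ expansion.range) :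
    @ChainRulePair (RatFunc ℂ) F _ _ S.algebra :=
  let _ := S.algebra
  { δ := S.δ
    Φ := S.Φ
    ρ := S.ι (HahnSeries.ofPowerSeries ℤ ℂ (PowerSeries.derivative ℂ R))
    δ_mem k := ⟨ratDeriv k, by
      change S.ι (expansion (ratDeriv k)) = S.δ (S.ι (expansion k))
      rw [S.δ_ι, ddt_expansion]⟩
    Φ_mem k := by
      obtain ⟨l, hl⟩ := Phi_expansion_mem_range h0 hR hrat k
      exact ⟨l, (congrArg S.ι hl).trans (S.Φ_ι _).symm⟩
    ρ_mem := by
      obtain ⟨k, hk⟩ := derivative_mem_range hrat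
      exact ⟨k, congrArg S.ι hk⟩
    ρ_ne_zero := (map_ne_zero S.ι).mpr <|
      (map_ne_zero_iff _ HahnSeries.ofPowerSeries_injective).mpr
        (derivative_ne_zero_of_constantCoeff_eq_zero h0 hR)
    chain_rule := S.chain_rule
    mem_of_Φ_eq_self x hx := by
      obtain ⟨c, rfl⟩ := S.eq_C_of_Φ_eq_self x hx
      exact ⟨RatFunc.C c, congrArg S.ι (expansion_C c)⟩ }

variable (hrat : HahnSeries.ofPowerSeries ℤ ℂ R ∈ expansion.range) {Ψ : F}
  (hΨ : S.Φ Ψ = S.ι (HahnSeries.ofPowerSeries ℤ ℂ (PowerSeries.derivative ℂ R)) * Ψ)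
  (htrans : IsDiffTranscendental (S.ι.comp expansion) S.δ Ψ)

include hrat hΨ htrans

lemma eq_zero_of_derivative_mul_Phi_eq_self {w : RatFunc ℂ}
    (hw : HahnSeries.ofPowerSeries ℤ ℂ (PowerSeries.derivative ℂ R) * Phi R h0 hR (expansion w) =
      expansion w) : w = 0 := by
  let _ := S.algebra
  have hΨ0 : Transcendental (RatFunc ℂ) Ψ :=
    ((isDiffTranscendental_iff S.δ Ψ).mp htrans).transcendental 0
  refine (map_eq_zero (S.ι.comp expansion)).mp <|
    (S.chainRulePair hrat).eq_zero_of_ρ_mul_Φ_eq_self hΨ hΨ0 ⟨w, rfl⟩ ?_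
  change S.ι _ * S.Φ (S.ι (expansion w)) = S.ι (expansion w)
  rw [S.Φ_ι, ← map_mul, hw]

lemma logDeriv_mem_range {a : RatFunc ℂ} {z : ℂ⸨X⸩} (hz0 : z ≠ 0)
    (hz : Phi R h0 hR z = expansion a * z) (hzalg : IsDiffAlgebraic expansion ddt z) :
    Differential.logDeriv z ∈ expansion.range := by
  let _ := S.algebra
  have : CharZero F := charZero_of_injective_ringHom (S.ι.comp HahnSeries.C).injective
  have hdep : ¬ AlgebraicIndependent (RatFunc ℂ) fun i : ℕ => S.δ^[i] (S.ι z) := by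
    rw [← isDiffTranscendental_iff]
    exact not_not_intro (isDiffAlgebraic_map S.ι S.δ_ι hzalg)
  obtain ⟨M, hMfg, hzM, hM⟩ :=
    exists_fg_differential_subfield S.δ (S.chainRulePair hrat).δ_mem hdep
  have hyM : S.ι (Differential.logDeriv z) ∈ M := by
    have hlog : S.ι (Differential.logDeriv z) = S.δ (S.ι z) / S.ι z := by
      rw [S.δ_ι, ← map_div₀]
      rfl
    rw [hlog]
    exact div_mem (hM _ hzM) hzM
  have hy : S.ι (HahnSeries.ofPowerSeries ℤ ℂ (PowerSeries.derivative ℂ R)) *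
      S.Φ (S.ι (Differential.logDeriv z)) =
      S.ι (Differential.logDeriv z) + S.ι (expansion (Differential.logDeriv a)) := by
    rw [S.Φ_ι, ← map_mul, derivative_mul_Phi_logDeriv_eq_add h0 hR hz0 hz, map_add]
  obtain ⟨h, hh⟩ := (S.chainRulePair hrat).mem_range_of_ρ_mul_Φ_eq_add hΨ
    ((isDiffTranscendental_iff S.δ Ψ).mp htrans) hMfg hM hyM ⟨Differential.logDeriv a, rfl⟩ hy
  exact ⟨h, S.ι.injective hh⟩

theorem exists_pow_mem_range {a : RatFunc ℂ} {z : ℂ⸨X⸩} (hz0 : z ≠ 0)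
    (hz : Phi R h0 hR z = expansion a * z) (hzalg : IsDiffAlgebraic expansion ddt z) :
    ∃ N : ℕ, 0 < N ∧ z ^ N ∈ expansion.range := by
  obtain ⟨h, hh⟩ := S.logDeriv_mem_range hrat hΨ htrans hz0 hz hzalg
  obtain ⟨τ, hτ⟩ := exists_algHom_expansion h0 hR hrat
  have hτX : expansion (ratDeriv (τ RatFunc.X)) =
      HahnSeries.ofPowerSeries ℤ ℂ (PowerSeries.derivative ℂ R) := by
    rw [← ddt_expansion, hτ, ddt_Phi, ddt_expansion]
    simp [ratDeriv]
  have ha : a ≠ 0 := coeff_ne_zero_of_Phi_eq_mul h0 hR hz0 hz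
  obtain ⟨N, hN, v, hv, hNv⟩ := exists_nat_mul_eq_logDeriv τ (a := a) (h := h)
    (fun w hw => S.eq_zero_of_derivative_mul_Phi_eq_self hrat hΨ htrans (by
      rw [← hτX, ← hτ, ← map_mul, hw])) ha (expansion.injective (by
      rw [map_mul, map_add, hτX, hτ, hh, derivative_mul_Phi_logDeriv_eq_add h0 hR hz0 hz]))
  refine ⟨N, hN, pow_mem_range_of_mul_logDeriv_eq hz0 hv ?_⟩
  rw [← hh, ← hNv, map_mul, map_natCast]

end SubstitutionExtension

end IterativeEquation

theorem mainTheorem6 (R : PowerSeries ℂ) (hR : IterativeEquation.DT R) (a : RatFunc ℂ)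
    (z : LaurentSeries ℂ)
    (hz : IterativeEquation.Phi R hR.map_zero hR.ne_zero z = IterativeEquation.expansion a * z) :
    (IsAlgebraic (RatFunc ℂ) z ∧
        ∃ N : ℕ, 0 < N ∧ z ^ N ∈ IterativeEquation.expansion.range) ∨
      IterativeEquation.IsDiffTranscendental IterativeEquation.expansion IterativeEquation.ddt z := by
  open IterativeEquation in
  rw [or_iff_not_imp_right, IsDiffTranscendental, not_not]
  intro hzalg
  suffices h : ∃ N : ℕ, 0 < N ∧ z ^ N ∈ expansion.range by
    obtain ⟨N, hN, k, hk⟩ := h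
    exact ⟨.of_pow hN (hk ▸ isAlgebraic_algebraMap k), N, hN, k, hk⟩
  by_cases hz0 : z = 0
  · exact ⟨1, one_pos, 0, by rw [hz0, map_zero, pow_one]⟩
  obtain ⟨-, Ψ, hΨ, htrans⟩ | ⟨h1, ℓ, -, Ψ, hΨ, htrans⟩ := hR.exists_psi
  · exact (SubstitutionExtension.laurent hR.iter_ne).exists_pow_mem_range hR.rational hΨ htrans
      hz0 hz hzalg
  · exact (SubstitutionExtension.logarithmic ℓ h1).exists_pow_mem_range hR.rational hΨ htrans
      hz0 hz hzalg
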